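/- Let $G$ be a group and let $A=\{A_p\}_{p\in G}$ be a family of associative algebras over $\mathbb{C}$ (not necessarily unital) with nondegenerate products. Write $M(B)$ for the multiplier algebra of $B$. Let $\Delta=\{\Delta_{p,q}:A_{pq}\to M(A_p\otimes A_q)\}_{p,q\in G}$ be a family of algebra homomorphisms such that $(A,\Delta)$ is a regular multiplier Hopf $G$-coalgebra, that is, for all $p,q,r\in G$: (1) $\Delta_{p,q}(a)(1\otimes b)\in A_p\otimes A_q$ for $a\in A_{pq}$, $b\in A_q$, and $(a\otimes 1)\Delta_{p,q}(b)\in A_p\otimes A_q$ for $a\in A_p$, $b\in A_{pq}$; (2) $(a\otimes1\otimes1)(\Delta_{p,q}\otimes I)(\Delta_{pq,r}(b)(1\otimes c))=(I\otimes\Delta_{q,r})((a\otimes1)\Delta_{p,qr}(b))(1\otimes1\otimes c)$ for $a\in A_p$, $b\in A_{pqr}$, $c\in A_r$; (3) the linear maps $A_{pq}\otimes A_q\to A_p\otimes A_q$, $a\otimes b\mapsto\Delta_{p,q}(a)(1\otimes b)$, and $A_p\otimes A_{pq}\to A_p\otimes A_q$, $a\otimes b\mapsto(a\otimes1)\Delta_{p,q}(b)$,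 are bijective; (4) the opposite family $\Delta'_{p,q}=\sigma\Delta_{p,q}:A_{pq}\to M(A_q\otimes A_p)$, where $\sigma$ is the flip, satisfies the corresponding conditions: $\Delta'_{p,q}(a)(1\otimes b)\in A_q\otimes A_p$ for $a\in A_{pq}$, $b\in A_p$ and $(a\otimes1)\Delta'_{p,q}(b)\in A_q\otimes A_p$ for $a\in A_q$, $b\in A_{pq}$; the resulting linear maps $A_{pq}\otimes A_p\to A_q\otimes A_p$ and $A_q\otimes A_{pq}\to A_q\otimes A_p$ are bijective; and $(a\otimes1\otimes1)(\Delta'_{q,p}\otimes I)(\Delta'_{r,qp}(b)(1\otimes c))=(I\otimes\Delta'_{r,q})((a\otimes1)\Delta'_{rq,p}(b))(1\otimes1\otimes c)$ for $a\in A_p$, $b\in A_{rqp}$, $c\in A_r$. A family $\varphi=\{\varphi_p:A_p\to\mathbb{C}\}_{p\in G}$ of linear functionals is called left invariant if $(I\otimes\varphi_q)\Delta_{p,q}(a)=\varphi_{pq}(a)1$ in $M(A_p)$ for all $p,q\in G$ and $a\in A_{pq}$, and right invariant if $(\varphi_p\otimes I)\Delta_{p,q}(a)=\varphi_{pq}(a)1$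 in $M(A_q)$ for all $p,q\in G$ and $a\in A_{pq}$. Here $(I\otimes\omega)\Delta_{p,q}(a)$ is the multiplier $n\in M(A_p)$ with $nb=(I\otimes\omega)(\Delta_{p,q}(a)(b\otimes1))$ and $bn=(I\otimes\omega)((b\otimes1)\Delta_{p,q}(a))$ for $b\in A_p$, and $(\omega\otimes I)\Delta_{p,q}(a)\in M(A_q)$ is defined similarly. The family is nonzero if $\varphi_p\neq0$ for some $p$. Then: (i) If $\varphi$ is a nonzero left invariant family of functionals, then every left invariant family $\varphi'$ is a scalar multiple of it: there is $c\in\mathbb{C}$ with $\varphi'_p=c\,\varphi_p$ for all $p\in G$. Moreover every member $\varphi_p$ is faithful: for $a\in A_p$, if $\varphi_p(ab)=0$ for all $b\in A_p$ then $a=0$, and if $\varphi_p(ba)=0$ for all $b\in A_p$ then $a=0$. (ii) If $\psi$ is a nonzero right invariant family of functionals, then every right invariant family $\psi'$ is a scalar multiple of it, with one scalar for all $p\in G$, and every member $\psi_p$ is faithful. -/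

import Mathlib

open scoped TensorProduct

noncomputable section

namespace MultiplierHopf

universe u v

section MultiplierAlgebra

/-- The product of `A` is nondegenerate: `ab = 0` for all `a` forces `b = 0`, and
`ab = 0` for all `b` forces `a = 0`. -/
def HasNondegenerateProduct (A : Type u) [NonUnitalRing A] : Prop :=
  (∀ b : A, (∀ a : A, a * b = 0) → b = 0) ∧ (∀ a : A, (∀ b : A, a * b = 0) → a = 0)

variable (A : Type u) [NonUnitalRing A] [Module ℂ A] [IsScalarTower ℂ A A] [SMulCommClass ℂ A A]
variable (B : Type v) [NonUnitalRing B] [Module ℂ B] [IsScalarTower ℂ B B] [SMulCommClass ℂ B B]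

/-- The algebra `M(A)` of (double) multipliers of an associative complex algebra `A`, with or
without unit. A multiplier is a pair `(L, R)` of linear maps `A → A` such that
`L (a b) = L a * b`, `R (a b) = a * R b` and `R a * b = a * L b`. The product is composition,
`(L₁, R₁) (L₂, R₂) = (L₁ ∘ L₂, R₂ ∘ R₁)`, which is why `R` is stored in the opposite algebra. -/
def multiplierSubalgebra : Subalgebra ℂ (Module.End ℂ A × (Module.End ℂ A)ᵐᵒᵖ) where
  carrier := {m | (∀ a b : A, m.1 (a * b) = m.1 a * b) ∧
    (∀ a b : A, m.2.unop (a * b) = a * m.2.unop b) ∧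
    (∀ a b : A, m.2.unop a * b = a * m.1 b)}
  mul_mem' := by
    rintro ⟨L₁, R₁⟩ ⟨L₂, R₂⟩ ⟨h₁, h₂, h₃⟩ ⟨k₁, k₂, k₃⟩
    refine ⟨fun a b => ?_, fun a b => ?_, fun a b => ?_⟩ <;> simp_all [Module.End.mul_apply]
  add_mem' := by
    rintro ⟨L₁, R₁⟩ ⟨L₂, R₂⟩ ⟨h₁, h₂, h₃⟩ ⟨k₁, k₂, k₃⟩
    refine ⟨fun a b => ?_, fun a b => ?_, fun a b => ?_⟩ <;> simp_all [add_mul, mul_add]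
  algebraMap_mem' := by
    intro r
    refine ⟨fun a b => ?_, fun a b => ?_, fun a b => ?_⟩ <;>
      simp [Algebra.algebraMap_eq_smul_one, smul_mul_assoc, mul_smul_comm]

/-- The multiplier algebra `M(A)`. -/
abbrev Multiplier : Type u := multiplierSubalgebra A

variable {A B}

/-- The left multiplier `a ↦ m a` underlying `m ∈ M(A)`. -/
def Multiplier.left (m : Multiplier A) : A →ₗ[ℂ] A := m.1.1

/-- The right multiplier `a ↦ a m` underlying `m ∈ M(A)`. -/
def Multiplier.right (m : Multiplier A) : A →ₗ[ℂ] A := m.1.2.unop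

lemma Multiplier.left_mul (m : Multiplier A) (a b : A) : m.left (a * b) = m.left a * b :=
  m.2.1 a b

lemma Multiplier.right_mul (m : Multiplier A) (a b : A) : m.right (a * b) = a * m.right b :=
  m.2.2.1 a b

lemma Multiplier.right_mul_left (m : Multiplier A) (a b : A) : m.right a * b = a * m.left b :=
  m.2.2.2 a b

/-- The multiplier with prescribed left and right parts. -/
def Multiplier.mk (L R : A →ₗ[ℂ] A) (hL : ∀ a b : A, L (a * b) = L a * b)
    (hR : ∀ a b : A, R (a * b) = a * R b) (hLR : ∀ a b : A, R a * b = a * L b) : Multiplier A :=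
  ⟨(L, MulOpposite.op R), hL, hR, hLR⟩

lemma Multiplier.ext' {m n : Multiplier A} (hl : ∀ a, m.left a = n.left a)
    (hr : ∀ a, m.right a = n.right a) : m = n :=
  Subtype.ext (Prod.ext (LinearMap.ext hl) (MulOpposite.unop_injective (LinearMap.ext hr)))

/-- The natural map `A → M(A)`, `a ↦ (a ·, · a)`. It is injective when the product of `A` is
nondegenerate, and `A` is then regarded as a subset of `M(A)`. -/
def ofElem : A →ₗ[ℂ] Multiplier A where
  toFun a := Multiplier.mk (LinearMap.mulLeft ℂ a) (LinearMap.mulRight ℂ a)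
    (fun _ _ => (mul_assoc _ _ _).symm) (fun _ _ => mul_assoc _ _ _) (fun _ _ => mul_assoc _ _ _)
  map_add' _ _ := Multiplier.ext' (fun _ => add_mul _ _ _) (fun _ => mul_add _ _ _)
  map_smul' _ _ := Multiplier.ext' (fun _ => smul_mul_assoc _ _ _) (fun _ => mul_smul_comm _ _ _)

/-- For `m ∈ M(A)` and `n ∈ M(B)`, the multiplier `m ⊗ n` of `A ⊗ B`. -/
def tmulMultiplier (m : Multiplier A) (n : Multiplier B) : Multiplier (A ⊗[ℂ] B) :=
  Multiplier.mk (TensorProduct.map m.left n.left) (TensorProduct.map m.right n.right)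
    (fun x y => by
      induction x with
      | zero => simp
      | add x₁ x₂ h₁ h₂ => simp only [add_mul, map_add, h₁, h₂]
      | tmul a b =>
        induction y with
        | zero => simp
        | add y₁ y₂ h₁ h₂ => simp only [mul_add, map_add, h₁, h₂]
        | tmul a' b' => simp [Algebra.TensorProduct.tmul_mul_tmul, Multiplier.left_mul])
    (fun x y => by
      induction x with
      | zero => simp
      | add x₁ x₂ h₁ h₂ => simp only [add_mul, map_add, h₁, h₂]
      | tmul a b =>
        induction y with
        | zero => simp
        | add y₁ y₂ h₁ h₂ => simp only [mul_add, map_add, h₁, h₂]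
        | tmul a' b' => simp [Algebra.TensorProduct.tmul_mul_tmul, Multiplier.right_mul])
    (fun x y => by
      induction x with
      | zero => simp
      | add x₁ x₂ h₁ h₂ => simp only [add_mul, map_add, h₁, h₂]
      | tmul a b =>
        induction y with
        | zero => simp
        | add y₁ y₂ h₁ h₂ => simp only [mul_add, map_add, h₁, h₂]
        | tmul a' b' =>
          simp [Algebra.TensorProduct.tmul_mul_tmul, Multiplier.right_mul_left])

/-- The natural linear map `M(A) ⊗ M(B) → M(A ⊗ B)`. -/
def tensorMultiplier : Multiplier A ⊗[ℂ] Multiplier B →ₗ[ℂ] Multiplier (A ⊗[ℂ] B) :=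
  TensorProduct.lift <| LinearMap.mk₂ ℂ tmulMultiplier
    (fun m m' n => Multiplier.ext'
      (fun x => LinearMap.congr_fun (TensorProduct.map_add_left m.left m'.left n.left) x)
      (fun x => LinearMap.congr_fun (TensorProduct.map_add_left m.right m'.right n.right) x))
    (fun c m n => Multiplier.ext'
      (fun x => LinearMap.congr_fun (TensorProduct.map_smul_left c m.left n.left) x)
      (fun x => LinearMap.congr_fun (TensorProduct.map_smul_left c m.right n.right) x))
    (fun m n n' => Multiplier.ext'
      (fun x => LinearMap.congr_fun (TensorProduct.map_add_right m.left n.left n'.left) x)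
      (fun x => LinearMap.congr_fun (TensorProduct.map_add_right m.right n.right n'.right) x))
    (fun c m n => Multiplier.ext'
      (fun x => LinearMap.congr_fun (TensorProduct.map_smul_right c m.left n.left) x)
      (fun x => LinearMap.congr_fun (TensorProduct.map_smul_right c m.right n.right) x))

/-- Transport of multipliers along a multiplicative linear isomorphism `e : A ≃ B`, that is,
`m ↦ e m e⁻¹`. -/
def Multiplier.congr (e : A ≃ₗ[ℂ] B) (he : ∀ x y, e (x * y) = e x * e y) :
    Multiplier A →ₗ[ℂ] Multiplier B where
  toFun m := Multiplier.mk (e.toLinearMap ∘ₗ m.left ∘ₗ e.symm.toLinearMap)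
    (e.toLinearMap ∘ₗ m.right ∘ₗ e.symm.toLinearMap)
    (fun a b => by
      have h : e.symm (a * b) = e.symm a * e.symm b := e.injective (by simp [he])
      simp [h, Multiplier.left_mul, he])
    (fun a b => by
      have h : e.symm (a * b) = e.symm a * e.symm b := e.injective (by simp [he])
      simp [h, Multiplier.right_mul, he])
    (fun a b => by
      have h := congrArg e (m.right_mul_left (e.symm a) (e.symm b))
      simpa [he] using h)
  map_add' m n := Multiplier.ext' (fun _ => map_add e _ _) (fun _ => map_add e _ _)
  map_smul' c m := Multiplier.ext' (fun _ => map_smul e _ _) (fun _ => map_smul e _ _)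

lemma comm_mul (x y : A ⊗[ℂ] B) :
    TensorProduct.comm ℂ A B (x * y) = TensorProduct.comm ℂ A B x * TensorProduct.comm ℂ A B y := by
  induction x with
  | zero => simp
  | add x₁ x₂ h₁ h₂ => simp only [add_mul, map_add, h₁, h₂]
  | tmul a b =>
    induction y with
    | zero => simp
    | add y₁ y₂ h₁ h₂ => simp only [mul_add, map_add, h₁, h₂]
    | tmul a' b' => simp [Algebra.TensorProduct.tmul_mul_tmul]

/-- The flip `σ : M(A ⊗ B) → M(B ⊗ A)`. -/
def flip : Multiplier (A ⊗[ℂ] B) →ₗ[ℂ] Multiplier (B ⊗[ℂ] A) :=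
  Multiplier.congr (TensorProduct.comm ℂ A B) comm_mul

variable {C : Type*} [NonUnitalRing C] [Module ℂ C] [IsScalarTower ℂ C C] [SMulCommClass ℂ C C]

lemma assoc_mul (x y : (A ⊗[ℂ] B) ⊗[ℂ] C) :
    TensorProduct.assoc ℂ A B C (x * y)
      = TensorProduct.assoc ℂ A B C x * TensorProduct.assoc ℂ A B C y := by
  induction x with
  | zero => simp
  | add x₁ x₂ h₁ h₂ => simp only [add_mul, map_add, h₁, h₂]
  | tmul u c =>
    induction y with
    | zero => simp
    | add y₁ y₂ h₁ h₂ => simp only [mul_add, map_add, h₁, h₂]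
    | tmul u' c' =>
      induction u with
      | zero => simp
      | add x₁ x₂ h₁ h₂ => simp only [TensorProduct.add_tmul, add_mul, map_add, h₁, h₂]
      | tmul a b =>
        induction u' with
        | zero => simp
        | add y₁ y₂ h₁ h₂ => simp only [TensorProduct.add_tmul, mul_add, map_add, h₁, h₂]
        | tmul a' b' => simp [Algebra.TensorProduct.tmul_mul_tmul]

/-- The identification `M((A ⊗ B) ⊗ C) → M(A ⊗ (B ⊗ C))` induced by the associator. -/
def assocMultiplier :
    Multiplier ((A ⊗[ℂ] B) ⊗[ℂ] C) →ₗ[ℂ] Multiplier (A ⊗[ℂ] (B ⊗[ℂ] C)) :=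
  Multiplier.congr (TensorProduct.assoc ℂ A B C) assoc_mul

variable (A) in
/-- The multiplier `1 ⊗ b` of `A ⊗ B`. -/
def oneTmul (b : B) : Multiplier (A ⊗[ℂ] B) := tmulMultiplier 1 (ofElem b)

variable (B) in
/-- The multiplier `a ⊗ 1` of `A ⊗ B`. -/
def tmulOne (a : A) : Multiplier (A ⊗[ℂ] B) := tmulMultiplier (ofElem a) 1

end MultiplierAlgebra

section Comultiplication

variable {A : Type*} [NonUnitalRing A] [Module ℂ A] [IsScalarTower ℂ A A] [SMulCommClass ℂ A A]
variable {B : Type*} [NonUnitalRing B] [Module ℂ B] [IsScalarTower ℂ B B] [SMulCommClass ℂ B B]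
variable {C : Type*} [NonUnitalRing C] [Module ℂ C] [IsScalarTower ℂ C C] [SMulCommClass ℂ C C]
variable {U : Type*} [NonUnitalRing U] [Module ℂ U] [IsScalarTower ℂ U U] [SMulCommClass ℂ U U]
variable {V : Type*} [NonUnitalRing V] [Module ℂ V] [IsScalarTower ℂ V V] [SMulCommClass ℂ V V]

/-- For a linear map `D : U → M(A ⊗ B)`, the linear map `U ⊗ B → M(A ⊗ B)`,
`u ⊗ b ↦ D(u)(1 ⊗ b)`. -/
def T₁ (D : U →ₗ[ℂ] Multiplier (A ⊗[ℂ] B)) : U ⊗[ℂ] B →ₗ[ℂ] Multiplier (A ⊗[ℂ] B) :=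
  TensorProduct.lift ((LinearMap.mul ℂ (Multiplier (A ⊗[ℂ] B))).compl₁₂ D
    (tensorMultiplier ∘ₗ TensorProduct.mk ℂ (Multiplier A) (Multiplier B) 1 ∘ₗ ofElem))

/-- For a linear map `D : U → M(A ⊗ B)`, the linear map `A ⊗ U → M(A ⊗ B)`,
`a ⊗ u ↦ (a ⊗ 1)D(u)`. -/
def T₂ (D : U →ₗ[ℂ] Multiplier (A ⊗[ℂ] B)) : A ⊗[ℂ] U →ₗ[ℂ] Multiplier (A ⊗[ℂ] B) :=
  TensorProduct.lift ((LinearMap.mul ℂ (Multiplier (A ⊗[ℂ] B))).compl₁₂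
    (tensorMultiplier ∘ₗ (TensorProduct.mk ℂ (Multiplier A) (Multiplier B)).flip 1 ∘ₗ ofElem) D)

lemma T₁_tmul (D : U →ₗ[ℂ] Multiplier (A ⊗[ℂ] B)) (u : U) (b : B) :
    T₁ D (u ⊗ₜ b) = D u * oneTmul A b := rfl

lemma T₂_tmul (D : U →ₗ[ℂ] Multiplier (A ⊗[ℂ] B)) (a : A) (u : U) :
    T₂ D (a ⊗ₜ u) = tmulOne B a * D u := rfl

/-- `D(u)(1 ⊗ b) ∈ A ⊗ B` and `(a ⊗ 1)D(u) ∈ A ⊗ B` for all `u`, `a`, `b`. -/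
def IsCovered (D : U →ₗ[ℂ] Multiplier (A ⊗[ℂ] B)) : Prop :=
  (∀ (u : U) (b : B), D u * oneTmul A b ∈ Set.range (ofElem (A := A ⊗[ℂ] B))) ∧
  (∀ (a : A) (u : U), tmulOne B a * D u ∈ Set.range (ofElem (A := A ⊗[ℂ] B)))

/-- `u ⊗ b ↦ D(u)(1 ⊗ b)` and `a ⊗ u ↦ (a ⊗ 1)D(u)` are bijections of `U ⊗ B` and of `A ⊗ U`
onto `A ⊗ B`, regarded as a subset of `M(A ⊗ B)`. -/
def HasBijectiveCanonicalMaps (D : U →ₗ[ℂ] Multiplier (A ⊗[ℂ] B)) : Prop :=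
  Set.BijOn (T₁ D) Set.univ (Set.range (ofElem (A := A ⊗[ℂ] B))) ∧
  Set.BijOn (T₂ D) Set.univ (Set.range (ofElem (A := A ⊗[ℂ] B)))

/-- The coassociativity identity
`(a ⊗ 1 ⊗ 1)(D ⊗ I)(d (1 ⊗ c)) = (I ⊗ D')((a ⊗ 1) d')(1 ⊗ 1 ⊗ c)` for all `a ∈ A`, `c ∈ C`,
in `M(A ⊗ B ⊗ C)`, where `d ∈ M(U ⊗ C)`, `D : U → M(A ⊗ B)`, `d' ∈ M(A ⊗ V)` and
`D' : V → M(B ⊗ C)`. Here `x` is the element `d (1 ⊗ c)` of `U ⊗ C` and `y` is the element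
`(a ⊗ 1) d'` of `A ⊗ V`. -/
def CoassocIdentity (d : Multiplier (U ⊗[ℂ] C)) (D : U →ₗ[ℂ] Multiplier (A ⊗[ℂ] B))
    (d' : Multiplier (A ⊗[ℂ] V)) (D' : V →ₗ[ℂ] Multiplier (B ⊗[ℂ] C)) : Prop :=
  ∀ (a : A) (c : C) (x : U ⊗[ℂ] C) (y : A ⊗[ℂ] V),
    ofElem x = d * oneTmul U c → ofElem y = tmulOne V a * d' →
    assocMultiplier
        (tmulMultiplier (tmulOne B a) 1 * tensorMultiplier (TensorProduct.map D ofElem x))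
      = tensorMultiplier (TensorProduct.map ofElem D' y) * tmulMultiplier 1 (oneTmul B c)

/-- `n ∈ M(A)` is the multiplier `(I ⊗ ω)(d)` for `d ∈ M(A ⊗ B)` and a linear functional `ω`
on `B`: for all `a ∈ A`, `d (a ⊗ 1)` and `(a ⊗ 1) d` lie in `A ⊗ B`, and
`n a = (I ⊗ ω)(d (a ⊗ 1))` and `a n = (I ⊗ ω)((a ⊗ 1) d)`. -/
def IsRightSlice (ω : B →ₗ[ℂ] ℂ) (d : Multiplier (A ⊗[ℂ] B)) (n : Multiplier A) : Prop :=
  ∀ a : A,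
    (∃ x : A ⊗[ℂ] B, ofElem x = d * tmulOne B a ∧
      n.left a = TensorProduct.rid ℂ A (TensorProduct.map LinearMap.id ω x)) ∧
    (∃ x : A ⊗[ℂ] B, ofElem x = tmulOne B a * d ∧
      n.right a = TensorProduct.rid ℂ A (TensorProduct.map LinearMap.id ω x))

/-- `n ∈ M(B)` is the multiplier `(ω ⊗ I)(d)` for `d ∈ M(A ⊗ B)` and a linear functional `ω`
on `A`: for all `b ∈ B`, `d (1 ⊗ b)` and `(1 ⊗ b) d` lie in `A ⊗ B`, and
`n b = (ω ⊗ I)(d (1 ⊗ b))` and `b n = (ω ⊗ I)((1 ⊗ b) d)`. -/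
def IsLeftSlice (ω : A →ₗ[ℂ] ℂ) (d : Multiplier (A ⊗[ℂ] B)) (n : Multiplier B) : Prop :=
  ∀ b : B,
    (∃ x : A ⊗[ℂ] B, ofElem x = d * oneTmul A b ∧
      n.left b = TensorProduct.lid ℂ B (TensorProduct.map ω LinearMap.id x)) ∧
    (∃ x : A ⊗[ℂ] B, ofElem x = oneTmul A b * d ∧
      n.right b = TensorProduct.lid ℂ B (TensorProduct.map ω LinearMap.id x))

/-- A linear functional `ω` on an algebra is faithful if `ω(ab) = 0` for all `b` forces `a = 0`
and `ω(ba) = 0` for all `b` forces `a = 0`. -/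
def IsFaithful (ω : A →ₗ[ℂ] ℂ) : Prop :=
  (∀ a : A, (∀ b : A, ω (a * b) = 0) → a = 0) ∧ (∀ a : A, (∀ b : A, ω (b * a) = 0) → a = 0)

end Comultiplication

section GCoalgebra

variable {G : Type*} [Group G] {A : G → Type*} [∀ p, NonUnitalRing (A p)] [∀ p, Module ℂ (A p)]
  [∀ p, IsScalarTower ℂ (A p) (A p)] [∀ p, SMulCommClass ℂ (A p) (A p)]

/-- The identification `A_{(pq)r} = A_{p(qr)}`. -/
def castAssoc (p q r : G) (a : A (p * q * r)) : A (p * (q * r)) :=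
  cast (congrArg A (mul_assoc p q r)) a

/-- The linear map underlying `Δ_{p,q} : A_{pq} → M(A_p ⊗ A_q)`. -/
def comulLin (Δ : ∀ p q : G, A (p * q) →ₙₐ[ℂ] Multiplier (A p ⊗[ℂ] A q)) (p q : G) :
    A (p * q) →ₗ[ℂ] Multiplier (A p ⊗[ℂ] A q) :=
  (Δ p q : A (p * q) →ₗ[ℂ] Multiplier (A p ⊗[ℂ] A q))

/-- The opposite comultiplication `Δ'_{p,q} = σ Δ_{p,q} : A_{pq} → M(A_q ⊗ A_p)`. -/
def comulOp (Δ : ∀ p q : G, A (p * q) →ₙₐ[ℂ] Multiplier (A p ⊗[ℂ] A q)) (p q : G) :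
    A (p * q) →ₗ[ℂ] Multiplier (A q ⊗[ℂ] A p) :=
  flip ∘ₗ comulLin Δ p q

/-- A family of homomorphisms `Δ_{p,q} : A_{pq} → M(A_p ⊗ A_q)` is a comultiplication on the
family `A` of algebras. -/
structure IsComultiplication (Δ : ∀ p q : G, A (p * q) →ₙₐ[ℂ] Multiplier (A p ⊗[ℂ] A q)) :
    Prop where
  covered : ∀ p q : G, IsCovered (comulLin Δ p q)
  coassoc : ∀ (p q r : G) (b : A (p * q * r)),
    CoassocIdentity (Δ (p * q) r b) (comulLin Δ p q) (Δ p (q * r) (castAssoc p q r b))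
      (comulLin Δ q r)

/-- `(A, Δ)` is a multiplier Hopf `G`-coalgebra. -/
structure IsMultiplierHopf (Δ : ∀ p q : G, A (p * q) →ₙₐ[ℂ] Multiplier (A p ⊗[ℂ] A q)) :
    Prop extends IsComultiplication Δ where
  nondegenerate : ∀ p : G, HasNondegenerateProduct (A p)
  bijective : ∀ p q : G, HasBijectiveCanonicalMaps (comulLin Δ p q)

/-- `(A, Δ)` is a regular multiplier Hopf `G`-coalgebra. The field `op_coassoc` reads
`(a ⊗ 1 ⊗ 1)(Δ'_{q,p} ⊗ I)(Δ'_{r,qp}(b)(1 ⊗ c)) = (I ⊗ Δ'_{r,q})((a ⊗ 1)Δ'_{rq,p}(b))(1 ⊗ 1 ⊗ c)`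
for `a ∈ A_p`, `b ∈ A_{rqp}`, `c ∈ A_r`. -/
structure IsRegularMultiplierHopf
    (Δ : ∀ p q : G, A (p * q) →ₙₐ[ℂ] Multiplier (A p ⊗[ℂ] A q)) :
    Prop extends IsMultiplierHopf Δ where
  op_covered : ∀ p q : G, IsCovered (comulOp Δ p q)
  op_coassoc : ∀ (p q r : G) (b : A (r * q * p)),
    CoassocIdentity (comulOp Δ r (q * p) (castAssoc r q p b)) (comulOp Δ q p)
      (comulOp Δ (r * q) p b) (comulOp Δ r q)
  op_bijective : ∀ p q : G, HasBijectiveCanonicalMaps (comulOp Δ p q)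

/-- The family `φ` of functionals is left invariant: `(I ⊗ φ_q)Δ_{p,q}(a) = φ_{pq}(a) 1` in
`M(A_p)` for all `a ∈ A_{pq}`. -/
def IsLeftInvariant (Δ : ∀ p q : G, A (p * q) →ₙₐ[ℂ] Multiplier (A p ⊗[ℂ] A q))
    (φ : ∀ p : G, A p →ₗ[ℂ] ℂ) : Prop :=
  ∀ (p q : G) (a : A (p * q)), IsRightSlice (φ q) (Δ p q a) (φ (p * q) a • (1 : Multiplier (A p)))

/-- The family `ψ` of functionals is right invariant: `(ψ_p ⊗ I)Δ_{p,q}(a) = ψ_{pq}(a) 1` in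
`M(A_q)` for all `a ∈ A_{pq}`. -/
def IsRightInvariant (Δ : ∀ p q : G, A (p * q) →ₙₐ[ℂ] Multiplier (A p ⊗[ℂ] A q))
    (ψ : ∀ p : G, A p →ₗ[ℂ] ℂ) : Prop :=
  ∀ (p q : G) (a : A (p * q)), IsLeftSlice (ψ p) (Δ p q a) (ψ (p * q) a • (1 : Multiplier (A q)))

end GCoalgebra

end MultiplierHopf

end

/-!
Write `Δ(a) = a₁ ⊗ a₂`. The argument uses neither the antipode nor modular data, and it takes place
almost entirely in the single algebra `H = A_e`, which is an ordinary regular multiplier Hopf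
algebra; every other `B = A_p` only enters through its two coactions `B → M(B ⊗ H)` and
`B → M(H ⊗ B)`. A nonzero invariant family is nonzero on `H`, and invariance for `Δ_{p,e}` turns
statements about `φ_e` into statements about `φ_p` (`LeftInv.eq_smul`, `eq_zero_of_forall_apply_mul`).

*Faithfulness.* Let `N` be the set of `n` with `φ(an) = 0` for all `a`. Invariance and bijectivity
of the canonical maps give `n ∈ N` if and only if `Δ(n)(y ⊗ 1) ∈ H ⊗ N` for all `y`
(`form_T₃_eq_zero`, `form_eq_zero_of_T₃`), and then that `x ⊗ a ↦ (x ⊗ 1)Δ(a)` maps `H ⊗ N` onto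
itself (`form_eq_zero_of_lift_T₂`). Let `ε` be the counit, so that `(I ⊗ ε)((c ⊗ 1)Δ(a)) = ca`
(`exists_counit`). If `n ∈ N` and `y ⊗ n = ∑ (yᵢ ⊗ 1)Δ(nᵢ)` with `nᵢ ∈ N`, then
`ε(n) y = ∑ yᵢ nᵢ` lies in `N`. Thus `ε ≠ 0` on `N` would give `φ = 0`, and otherwise
`cn = (I ⊗ ε)((c ⊗ 1)Δ(n)) = 0` for all `n ∈ N`, so `N = 0`.

*Uniqueness.* For left invariant `φ`, `φ'` one has, with `X = a₁ φ(a₂ b)` and `Y = b₁ φ(a b₂)`,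
`φ(d₁) φ'(X d₂) = φ(Y) φ'(d)` (`apply_slR_T₄`). If `φ(d) = 0`, the case `φ' = φ` and faithfulness
give `φ(d₁) d₂ = 0`, whence `φ'(d) = 0`: the kernel of `φ` is contained in that of `φ'`.

Passing to the opposite products exchanges the two sides in faithfulness, and passing to the flipped
comultiplication exchanges left and right invariance. To have both symmetries available, the argument
is carried out for a structure `Cop` on vector spaces with a bilinear product, which records the
covered versions `Δ(a)(1 ⊗ b)`, … of a comultiplication and is stable under `Cop.op` and `Cop.coop`.
-/

namespace MultiplierHopf

/-! ### Slices, and comultiplications given by their covered versions -/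

section Slices

variable {K A B C X Y : Type*} [Field K] [AddCommGroup A] [Module K A] [AddCommGroup B] [Module K B]
  [AddCommGroup C] [Module K C] [AddCommGroup X] [Module K X] [AddCommGroup Y] [Module K Y]

/-- The slice map `I ⊗ ω : A ⊗ B → A`. -/
def slR (ω : B →ₗ[K] K) : A ⊗[K] B →ₗ[K] A := (TensorProduct.rid K A).toLinearMap ∘ₗ ω.lTensor A

/-- The slice map `ω ⊗ I : A ⊗ B → B`. -/
def slL (ω : A →ₗ[K] K) : A ⊗[K] B →ₗ[K] B := (TensorProduct.lid K B).toLinearMap ∘ₗ ω.rTensor B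

@[simp] lemma slR_tmul (ω : B →ₗ[K] K) (a : A) (b : B) : slR ω (a ⊗ₜ b) = ω b • a := by simp [slR]

@[simp] lemma slL_tmul (ω : A →ₗ[K] K) (a : A) (b : B) : slL ω (a ⊗ₜ b) = ω a • b := by simp [slL]

lemma slR_smul (c : K) (ω : B →ₗ[K] K) (z : A ⊗[K] B) : slR (c • ω) z = c • slR ω z := by
  simp [slR]

lemma slR_rTensor (ω : B →ₗ[K] K) (f : A →ₗ[K] X) (z : A ⊗[K] B) :
    slR ω (f.rTensor B z) = f (slR ω z) := by
  induction z with
  | zero => simp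
  | add x y hx hy => simp only [map_add, hx, hy]
  | tmul a b => simp

lemma slR_lTensor (ω : X →ₗ[K] K) (f : B →ₗ[K] X) (z : A ⊗[K] B) :
    slR ω (f.lTensor A z) = slR (ω ∘ₗ f) z := by
  induction z with
  | zero => simp
  | add x y hx hy => simp only [map_add, hx, hy]
  | tmul a b => simp

lemma slL_lTensor (ω : A →ₗ[K] K) (f : B →ₗ[K] X) (z : A ⊗[K] B) :
    slL ω (f.lTensor A z) = f (slL ω z) := by
  induction z with
  | zero => simp
  | add x y hx hy => simp only [map_add, hx, hy]
  | tmul a b => simp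

/-- Fubini for slices. -/
lemma apply_slR (ω : A →ₗ[K] K) (η : B →ₗ[K] K) (z : A ⊗[K] B) :
    ω (slR η z) = η (slL ω z) := by
  induction z with
  | zero => simp
  | add x y hx hy => simp only [map_add, hx, hy]
  | tmul a b => simp [mul_comm]

lemma slR_comm (ω : A →ₗ[K] K) (z : A ⊗[K] B) : slR ω (TensorProduct.comm K A B z) = slL ω z := by
  induction z with
  | zero => simp
  | add x y hx hy => simp only [map_add, hx, hy]
  | tmul a b => simp

lemma comm_rTensor (f : A →ₗ[K] X) (z : A ⊗[K] B) :
    TensorProduct.comm K X B (f.rTensor B z) = f.lTensor B (TensorProduct.comm K A B z) := by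
  induction z with
  | zero => simp
  | add x y hx hy => simp only [map_add, hx, hy]
  | tmul a b => simp

lemma comm_lTensor (f : B →ₗ[K] X) (z : A ⊗[K] B) :
    TensorProduct.comm K A X (f.lTensor A z) = f.rTensor A (TensorProduct.comm K A B z) := by
  induction z with
  | zero => simp
  | add x y hx hy => simp only [map_add, hx, hy]
  | tmul a b => simp

lemma lTensor_slR_assoc (ω : C →ₗ[K] K) (z : (A ⊗[K] B) ⊗[K] C) :
    (slR ω).lTensor A (TensorProduct.assoc K A B C z) = slR ω z := by
  induction z with
  | zero => simp
  | add x y hx hy => simp only [map_add, hx, hy]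
  | tmul u c =>
    induction u with
    | zero => simp
    | add x y hx hy => simp only [TensorProduct.add_tmul, map_add, hx, hy]
    | tmul a b => simp [TensorProduct.tmul_smul]

lemma slR_slR_assoc (η : B →ₗ[K] K) (ω : C →ₗ[K] K) (z : (A ⊗[K] B) ⊗[K] C) :
    slR (η ∘ₗ slR ω) (TensorProduct.assoc K A B C z) = slR ω ((slR η).rTensor C z) := by
  rw [slR_rTensor, ← slR_lTensor, lTensor_slR_assoc]

/-- Maps on the last leg commute with the associator. -/
lemma lTensor_lTensor_assoc (f : C →ₗ[K] X) (z : (A ⊗[K] B) ⊗[K] C) :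
    (f.lTensor B).lTensor A (TensorProduct.assoc K A B C z)
      = TensorProduct.assoc K A B X (f.lTensor (A ⊗[K] B) z) := by
  induction z with
  | zero => simp
  | add x y hx hy => simp only [map_add, hx, hy]
  | tmul u c =>
    induction u with
    | zero => simp
    | add x y hx hy => simp only [TensorProduct.add_tmul, map_add, hx, hy]
    | tmul a b => simp

/-- Maps on the middle leg commute with the associator. -/
lemma lTensor_rTensor_assoc (f : B →ₗ[K] X) (z : (A ⊗[K] B) ⊗[K] C) :
    (f.rTensor C).lTensor A (TensorProduct.assoc K A B C z)
      = TensorProduct.assoc K A X C ((f.lTensor A).rTensor C z) := by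
  induction z with
  | zero => simp
  | add x y hx hy => simp only [map_add, hx, hy]
  | tmul u c =>
    induction u with
    | zero => simp
    | add x y hx hy => simp only [TensorProduct.add_tmul, map_add, hx, hy]
    | tmul a b => simp

lemma rTensor_lTensor_comm (f : A →ₗ[K] X) (g : B →ₗ[K] Y) (z : A ⊗[K] B) :
    f.rTensor Y (g.lTensor A z) = g.lTensor X (f.rTensor B z) := by
  rw [← LinearMap.comp_apply, ← LinearMap.comp_apply, LinearMap.rTensor_comp_lTensor,
    LinearMap.lTensor_comp_rTensor]

/-- An element of `A ⊗ B` all of whose slices in `B` vanish is zero. -/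
lemma eq_zero_of_slL {z : A ⊗[K] B} (h : ∀ ω : A →ₗ[K] K, slL ω z = 0) : z = 0 := by
  classical
  let b := Module.Basis.ofVectorSpace K A
  apply (TensorProduct.equivFinsuppOfBasisLeft (N := B) b).injective
  rw [map_zero]
  ext i
  have key : ∀ z : A ⊗[K] B,
      TensorProduct.equivFinsuppOfBasisLeft (N := B) b z i = slL (b.coord i) z := by
    intro z
    induction z with
    | zero => simp
    | add x y hx hy => simp only [map_add, Finsupp.add_apply, hx, hy]
    | tmul a b => simp
  rw [key, h]; rfl

/-- Maps on the second leg with trivial common kernel separate the elements of `A ⊗ B`. -/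
lemma eq_of_lTensor {ι : Sort*} {f : ι → B →ₗ[K] X} (hf : ∀ b, (∀ i, f i b = 0) → b = 0)
    {z w : A ⊗[K] B} (h : ∀ i, (f i).lTensor A z = (f i).lTensor A w) : z = w := by
  rw [← sub_eq_zero]
  refine eq_zero_of_slL fun ω => hf _ fun i => ?_
  rw [← slL_lTensor, map_sub, h i, sub_self, map_zero]

/-- Maps on the first leg with trivial common kernel separate the elements of `A ⊗ B`. -/
lemma eq_of_rTensor {ι : Sort*} {f : ι → A →ₗ[K] X} (hf : ∀ a, (∀ i, f i a = 0) → a = 0)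
    {z w : A ⊗[K] B} (h : ∀ i, (f i).rTensor B z = (f i).rTensor B w) : z = w := by
  apply (TensorProduct.comm K A B).injective
  refine eq_of_lTensor hf fun i => ?_
  rw [← comm_rTensor, ← comm_rTensor, h i]

lemma tmul_right_cancel {b : B} (hb : b ≠ 0) {a a' : A} (h : a ⊗ₜ[K] b = a' ⊗ₜ[K] b) : a = a' := by
  obtain ⟨ω, hω⟩ : ∃ ω : B →ₗ[K] K, ω b ≠ 0 := by
    by_contra! H
    exact hb ((Module.forall_dual_apply_eq_zero_iff K b).1 H)
  have := congrArg (slR ω) h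
  simpa [hω] using this

end Slices

/-- An associative bilinear product on a vector space which is nondegenerate. Keeping the product
as data makes the opposite product available on the same vector space. -/
structure NDMul (K A : Type*) [Field K] [AddCommGroup A] [Module K A] where
  mul : A →ₗ[K] A →ₗ[K] A
  assoc : ∀ a b c, mul (mul a b) c = mul a (mul b c)
  left_cancel : ∀ b, (∀ a, mul a b = 0) → b = 0
  right_cancel : ∀ a, (∀ b, mul a b = 0) → a = 0

/-- The opposite product. -/
@[simps] def NDMul.op {K A : Type*} [Field K] [AddCommGroup A] [Module K A] (m : NDMul K A) :
    NDMul K A where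
  mul := m.mul.flip
  assoc a b c := (m.assoc c b a).symm
  left_cancel := m.right_cancel
  right_cancel := m.left_cancel

section Comul

variable {K U A B : Type*} [Field K] [AddCommGroup U] [Module K U] [AddCommGroup A] [Module K A]
  [AddCommGroup B] [Module K B]

/-- A regular comultiplication `Δ : U → M(A ⊗ B)`, encoded by the four ways of multiplying `Δ a`
with an element of one leg into `A ⊗ B`, together with the left and right multiplications by `Δ a`
on `A ⊗ B`:
`T₁ a b = Δ(a)(1 ⊗ b)`, `T₂ x a = (x ⊗ 1)Δ(a)`, `T₃ a x = Δ(a)(x ⊗ 1)`, `T₄ y a = (1 ⊗ y)Δ(a)`,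
`L a z = Δ(a)z` and `R a z = zΔ(a)`. The axioms are those relations between these maps which
express that products in `M(A ⊗ B)` are associative and that `Δ` is multiplicative, and the
bijectivity of the four canonical maps. Since `L` and `R` are data, no extension of `Δ` to
multipliers is needed. -/
structure Cop (mU : NDMul K U) (mA : NDMul K A) (mB : NDMul K B) where
  T₁ : U →ₗ[K] B →ₗ[K] A ⊗[K] B
  T₂ : A →ₗ[K] U →ₗ[K] A ⊗[K] B
  T₃ : U →ₗ[K] A →ₗ[K] A ⊗[K] B
  T₄ : B →ₗ[K] U →ₗ[K] A ⊗[K] B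
  L : U →ₗ[K] (A ⊗[K] B →ₗ[K] A ⊗[K] B)
  R : U →ₗ[K] (A ⊗[K] B →ₗ[K] A ⊗[K] B)
  T₁_bij : Function.Bijective (TensorProduct.lift T₁)
  T₂_bij : Function.Bijective (TensorProduct.lift T₂)
  T₃_bij : Function.Bijective (TensorProduct.lift T₃)
  T₄_bij : Function.Bijective (TensorProduct.lift T₄)
  T₁₂ : ∀ x a y, (mA.mul x).rTensor B (T₁ a y) = (mB.mul.flip y).lTensor A (T₂ x a)
  T₃₄ : ∀ y a x, (mB.mul y).lTensor A (T₃ a x) = (mA.mul.flip x).rTensor B (T₄ y a)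
  T₁₄ : ∀ y a y', (mB.mul y).lTensor A (T₁ a y') = (mB.mul.flip y').lTensor A (T₄ y a)
  T₂₃ : ∀ x a x', (mA.mul x).rTensor B (T₃ a x') = (mA.mul.flip x').rTensor B (T₂ x a)
  L_T₁ : ∀ a x y, L a (x ⊗ₜ y) = (mA.mul.flip x).rTensor B (T₁ a y)
  L_T₃ : ∀ a x y, L a (x ⊗ₜ y) = (mB.mul.flip y).lTensor A (T₃ a x)
  R_T₂ : ∀ a x y, R a (x ⊗ₜ y) = (mB.mul y).lTensor A (T₂ x a)
  R_T₄ : ∀ a x y, R a (x ⊗ₜ y) = (mA.mul x).rTensor B (T₄ y a)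
  T₁_mul : ∀ a a' y, T₁ (mU.mul a a') y = L a (T₁ a' y)
  T₃_mul : ∀ a a' x, T₃ (mU.mul a a') x = L a (T₃ a' x)
  T₂_mul : ∀ x a a', T₂ x (mU.mul a a') = R a' (T₂ x a)
  T₄_mul : ∀ y a a', T₄ y (mU.mul a a') = R a' (T₄ y a)
  T₁_right : ∀ a y y', T₁ a (mB.mul y y') = (mB.mul.flip y').lTensor A (T₁ a y)
  T₃_right : ∀ a x x', T₃ a (mA.mul x x') = (mA.mul.flip x').rTensor B (T₃ a x)
  T₂_left : ∀ x x' a, T₂ (mA.mul x x') a = (mA.mul x).rTensor B (T₂ x' a)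
  T₄_left : ∀ y y' a, T₄ (mB.mul y y') a = (mB.mul y).lTensor A (T₄ y' a)

variable {mU : NDMul K U} {mA : NDMul K A} {mB : NDMul K B}

lemma bijective_lift_flip {f : U →ₗ[K] A →ₗ[K] B} (h : Function.Bijective (TensorProduct.lift f)) :
    Function.Bijective (TensorProduct.lift f.flip) := by
  have : TensorProduct.lift f.flip
      = TensorProduct.lift f ∘ₗ (TensorProduct.comm K A U).toLinearMap := by
    ext; simp
  rw [this]
  exact h.comp (TensorProduct.comm K A U).bijective

lemma bijective_lift_compr₂ {C X : Type*} [AddCommGroup C] [Module K C] [AddCommGroup X]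
    [Module K X] {f : U →ₗ[K] C →ₗ[K] X} (h : Function.Bijective (TensorProduct.lift f))
    {Y : Type*} [AddCommGroup Y] [Module K Y] (e : X ≃ₗ[K] Y) :
    Function.Bijective (TensorProduct.lift (f.compr₂ e.toLinearMap)) := by
  have : TensorProduct.lift (f.compr₂ e.toLinearMap)
      = e.toLinearMap ∘ₗ TensorProduct.lift f := by
    ext; simp
  rw [this]
  exact e.bijective.comp h

/-- The same comultiplication for the opposite products. -/
@[simps] def Cop.op (D : Cop mU mA mB) : Cop mU.op mA.op mB.op where
  T₁ := D.T₄.flip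
  T₂ := D.T₃.flip
  T₃ := D.T₂.flip
  T₄ := D.T₁.flip
  L := D.R
  R := D.L
  T₁_bij := bijective_lift_flip D.T₄_bij
  T₂_bij := bijective_lift_flip D.T₃_bij
  T₃_bij := bijective_lift_flip D.T₂_bij
  T₄_bij := bijective_lift_flip D.T₁_bij
  T₁₂ x a y := (D.T₃₄ y a x).symm
  T₃₄ y a x := (D.T₁₂ x a y).symm
  T₁₄ y a y' := (D.T₁₄ y' a y).symm
  T₂₃ x a x' := (D.T₂₃ x' a x).symm
  L_T₁ a x y := D.R_T₄ a x y
  L_T₃ a x y := D.R_T₂ a x y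
  R_T₂ a x y := D.L_T₃ a x y
  R_T₄ a x y := D.L_T₁ a x y
  T₁_mul a a' y := D.T₄_mul y a' a
  T₃_mul a a' x := D.T₂_mul x a' a
  T₂_mul x a a' := D.T₃_mul a' a x
  T₄_mul y a a' := D.T₁_mul a' a y
  T₁_right a y y' := D.T₄_left y' y a
  T₃_right a x x' := D.T₂_left x' x a
  T₂_left x x' a := D.T₃_right a x' x
  T₄_left y y' a := D.T₁_right a y' y

/-- The opposite comultiplication `σ Δ : U → M(B ⊗ A)`. -/
@[simps] def Cop.coop (D : Cop mU mA mB) : Cop mU mB mA where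
  T₁ := D.T₃.compr₂ (TensorProduct.comm K A B).toLinearMap
  T₂ := D.T₄.compr₂ (TensorProduct.comm K A B).toLinearMap
  T₃ := D.T₁.compr₂ (TensorProduct.comm K A B).toLinearMap
  T₄ := D.T₂.compr₂ (TensorProduct.comm K A B).toLinearMap
  L := (TensorProduct.comm K A B).conj.toLinearMap ∘ₗ D.L
  R := (TensorProduct.comm K A B).conj.toLinearMap ∘ₗ D.R
  T₁_bij := bijective_lift_compr₂ D.T₃_bij _
  T₂_bij := bijective_lift_compr₂ D.T₄_bij _
  T₃_bij := bijective_lift_compr₂ D.T₁_bij _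
  T₄_bij := bijective_lift_compr₂ D.T₂_bij _
  T₁₂ x a y := by simp [← comm_rTensor, ← comm_lTensor, D.T₃₄]
  T₃₄ y a x := by simp [← comm_rTensor, ← comm_lTensor, D.T₁₂]
  T₁₄ y a y' := by simp [← comm_rTensor, D.T₂₃]
  T₂₃ x a x' := by simp [← comm_lTensor, D.T₁₄]
  L_T₁ a x y := by simp [LinearEquiv.conj_apply, ← comm_lTensor, D.L_T₃]
  L_T₃ a x y := by simp [LinearEquiv.conj_apply, ← comm_rTensor, D.L_T₁]
  R_T₂ a x y := by simp [LinearEquiv.conj_apply, ← comm_rTensor, D.R_T₄]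
  R_T₄ a x y := by simp [LinearEquiv.conj_apply, ← comm_lTensor, D.R_T₂]
  T₁_mul a a' y := by simp [LinearEquiv.conj_apply, D.T₃_mul]
  T₃_mul a a' y := by simp [LinearEquiv.conj_apply, D.T₁_mul]
  T₂_mul a a' y := by simp [LinearEquiv.conj_apply, D.T₄_mul]
  T₄_mul a a' y := by simp [LinearEquiv.conj_apply, D.T₂_mul]
  T₁_right a y y' := by simp [← comm_rTensor, D.T₃_right]
  T₃_right a y y' := by simp [← comm_lTensor, D.T₁_right]
  T₂_left a y y' := by simp [← comm_lTensor, D.T₄_left]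
  T₄_left a y y' := by simp [← comm_rTensor, D.T₂_left]

end Comul

section Coassoc

variable {K U V W A B C : Type*} [Field K] [AddCommGroup U] [Module K U] [AddCommGroup V]
  [Module K V] [AddCommGroup W] [Module K W] [AddCommGroup A] [Module K A] [AddCommGroup B]
  [Module K B] [AddCommGroup C] [Module K C]
  {mU : NDMul K U} {mV : NDMul K V} {mW : NDMul K W} {mA : NDMul K A} {mB : NDMul K B}
  {mC : NDMul K C}

/-- Coassociativity `(E ⊗ I) D = (I ⊗ E') D'`, as an identity between maps from `V` to the
multipliers of `A ⊗ B ⊗ C`, covered from the left on the first leg and from the right on the third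
leg (`c₂₁`), and the other way round (`c₃₄`). -/
structure Coassoc (E : Cop mU mA mB) (D : Cop mV mU mC) (D' : Cop mV mA mW) (E' : Cop mW mB mC) :
    Prop where
  c₂₁ : ∀ a v c, TensorProduct.assoc K A B C ((E.T₂ a).rTensor C (D.T₁ v c))
    = (E'.T₁.flip c).lTensor A (D'.T₂ a v)
  c₃₄ : ∀ a v c, TensorProduct.assoc K A B C ((E.T₃.flip a).rTensor C (D.T₄ c v))
    = (E'.T₄ c).lTensor A (D'.T₃ v a)

variable {E : Cop mU mA mB} {D : Cop mV mU mC} {D' : Cop mV mA mW} {E' : Cop mW mB mC}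

lemma Coassoc.op (h : Coassoc E D D' E') : Coassoc E.op D.op D'.op E'.op where
  c₂₁ := h.c₃₄
  c₃₄ := h.c₂₁

/-- Reversing the order of the three legs turns an identity `(g ⊗ I) w = (I ⊗ f) z` into
`(σf ⊗ I) σz = (I ⊗ σg) σw`. -/
lemma flip_assoc (f : W →ₗ[K] B ⊗[K] C) (g : U →ₗ[K] A ⊗[K] B) (z : A ⊗[K] W) (w : U ⊗[K] C)
    (h : TensorProduct.assoc K A B C (g.rTensor C w) = f.lTensor A z) :
    TensorProduct.assoc K C B A
        (((TensorProduct.comm K B C).toLinearMap ∘ₗ f).rTensor A (TensorProduct.comm K A W z))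
      = ((TensorProduct.comm K A B).toLinearMap ∘ₗ g).lTensor C (TensorProduct.comm K U C w) := by
  have h₁ : TensorProduct.assoc K C B A
        (((TensorProduct.comm K B C).toLinearMap ∘ₗ f).rTensor A (TensorProduct.comm K A W z))
      = TensorProduct.assoc K C B A ((TensorProduct.comm K B C).toLinearMap.rTensor A
          (TensorProduct.comm K A (B ⊗[K] C) (f.lTensor A z))) := by
    rw [comm_lTensor, LinearMap.rTensor_comp]; rfl
  have h₂ : ((TensorProduct.comm K A B).toLinearMap ∘ₗ g).lTensor C (TensorProduct.comm K U C w)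
      = (TensorProduct.comm K A B).toLinearMap.lTensor C
          (TensorProduct.comm K (A ⊗[K] B) C (g.rTensor C w)) := by
    rw [comm_rTensor, LinearMap.lTensor_comp]; rfl
  rw [h₁, h₂, ← h]
  generalize g.rTensor C w = t
  induction t with
  | zero => simp
  | add x y hx hy => simp only [map_add, hx, hy]
  | tmul u c =>
    induction u with
    | zero => simp
    | add x y hx hy => simp only [TensorProduct.add_tmul, map_add, hx, hy]
    | tmul a b => simp

lemma Coassoc.coop (h : Coassoc E D D' E') : Coassoc E'.coop D'.coop D.coop E.coop where
  c₂₁ c v a := flip_assoc (E'.T₄ c) (E.T₃.flip a) _ _ (h.c₃₄ a v c)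
  c₃₄ c v a := flip_assoc (E'.T₁.flip c) (E.T₂ a) _ _ (h.c₂₁ a v c)

/-- Coassociativity, covered from the left on the first and the third leg. -/
lemma Coassoc.c₂₄ (h : Coassoc E D D' E') (a : A) (v : V) (c : C) :
    TensorProduct.assoc K A B C ((E.T₂ a).rTensor C (D.T₄ c v))
      = (E'.T₄ c).lTensor A (D'.T₂ a v) := by
  -- After multiplying the third leg with `d` from the right both sides are `c` times `c₂₁`.
  refine eq_of_lTensor (f := fun d => (mC.mul.flip d).lTensor B) (fun z hz => ?_) fun d => ?_
  · exact eq_of_lTensor (f := fun d => mC.mul.flip d) mC.right_cancel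
      fun d => (hz d).trans (map_zero _).symm
  have h₁ : (mC.mul.flip d).lTensor B ∘ₗ E'.T₄ c = (mC.mul c).lTensor B ∘ₗ E'.T₁.flip d := by
    ext w; exact (E'.T₁₄ c w d).symm
  calc _ = TensorProduct.assoc K A B C ((mC.mul.flip d).lTensor (A ⊗[K] B)
          ((E.T₂ a).rTensor C (D.T₄ c v))) := lTensor_lTensor_assoc _ _
    _ = TensorProduct.assoc K A B C ((mC.mul c).lTensor (A ⊗[K] B)
          ((E.T₂ a).rTensor C (D.T₁ v d))) := by
        rw [← rTensor_lTensor_comm, ← D.T₁₄, rTensor_lTensor_comm]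
    _ = ((mC.mul c).lTensor B).lTensor A ((E'.T₁.flip d).lTensor A (D'.T₂ a v)) := by
        rw [← lTensor_lTensor_assoc, h.c₂₁]
    _ = _ := by
        rw [← LinearMap.comp_apply, ← LinearMap.lTensor_comp, ← h₁, LinearMap.lTensor_comp,
          LinearMap.comp_apply]

/-- The element `(I ⊗ Δ)Δ(b)(z ⊗ 1)` of `A ⊗ A ⊗ A`, for `z ∈ A ⊗ A`. -/
def Cop.comul₂ (D : Cop mA mA mA) (b : A) : A ⊗[K] A →ₗ[K] A ⊗[K] (A ⊗[K] A) :=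
  TensorProduct.lift ((LinearMap.lTensorHom A ∘ₗ D.T₃.flip).flip ∘ₗ D.T₃ b)

lemma Cop.comul₂_tmul (D : Cop mA mA mA) (b e f : A) :
    D.comul₂ b (e ⊗ₜ f) = (D.T₃.flip f).lTensor A (D.T₃ b e) := rfl

/-- Coassociativity `(Δ ⊗ I)(Δ(b)(f ⊗ 1))(e ⊗ 1 ⊗ 1) = (I ⊗ Δ)Δ(b)(Δ(f)(e ⊗ 1) ⊗ 1)`. -/
lemma Coassoc.comul₂_T₃ {D : Cop mA mA mA} (h : Coassoc D D D D) (b f e : A) :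
    D.comul₂ b (D.T₃ f e) = TensorProduct.assoc K A A A ((D.T₃.flip e).rTensor A (D.T₃ b f)) := by
  -- Multiply the third leg with `a` from the left, which allows to use `c₃₄`.
  refine eq_of_lTensor (f := fun a => (mA.mul a).lTensor A) (fun z hz => ?_) fun a => ?_
  · exact eq_of_lTensor (f := fun d => mA.mul d) mA.left_cancel
      fun d => (hz d).trans (map_zero _).symm
  have key : ∀ z, ((mA.mul a).lTensor A).lTensor A (D.comul₂ b z)
      = TensorProduct.assoc K A A A ((D.L.flip z).rTensor A (D.T₄ a b)) := by
    intro z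
    induction z with
    | zero => simp
    | add x y hx hy => simp only [map_add, hx, hy, LinearMap.rTensor_add, LinearMap.add_apply]
    | tmul x y =>
      have h₁ : (mA.mul a).lTensor A ∘ₗ D.T₃.flip y = (mA.mul.flip y).rTensor A ∘ₗ D.T₄ a := by
        ext v; exact D.T₃₄ a v y
      have h₂ : D.L.flip (x ⊗ₜ y) = (mA.mul.flip y).lTensor A ∘ₗ D.T₃.flip x := by
        ext v; exact D.L_T₃ v x y
      rw [Cop.comul₂_tmul, ← LinearMap.comp_apply, ← LinearMap.lTensor_comp, h₁,
        LinearMap.lTensor_comp, LinearMap.comp_apply, ← h.c₃₄, lTensor_rTensor_assoc, h₂,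
        LinearMap.rTensor_comp, LinearMap.comp_apply]
  have h₃ : D.L.flip (D.T₃ f e) = D.T₃.flip e ∘ₗ mA.mul.flip f := by
    ext v; exact (D.T₃_mul v f e).symm
  rw [key, lTensor_lTensor_assoc, ← rTensor_lTensor_comm, D.T₃₄, h₃, LinearMap.rTensor_comp,
    LinearMap.comp_apply]

end Coassoc

/-! ### Faithfulness -/

section Invariance

variable {K U A B : Type*} [Field K] [AddCommGroup U] [Module K U] [AddCommGroup A] [Module K A]
  [AddCommGroup B] [Module K B] {mU : NDMul K U} {mA : NDMul K A} {mB : NDMul K B}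

/-- `(I ⊗ φB) Δ = φU(·) 1`, from both sides. -/
structure LeftInv (D : Cop mU mA mB) (φU : U →ₗ[K] K) (φB : B →ₗ[K] K) : Prop where
  T₃ : ∀ a x, slR φB (D.T₃ a x) = φU a • x
  T₂ : ∀ x a, slR φB (D.T₂ x a) = φU a • x

lemma LeftInv.op {D : Cop mU mA mB} {φU : U →ₗ[K] K} {φB : B →ₗ[K] K} (h : LeftInv D φU φB) :
    LeftInv D.op φU φB :=
  ⟨fun a x => h.T₂ x a, fun x a => h.T₃ a x⟩

/-- The linear map `n ↦ φ(· n)`. Its kernel is the left ideal of all `n` with `φ(a n) = 0` for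
all `a`. -/
def form (mB : NDMul K B) (φ : B →ₗ[K] K) : B →ₗ[K] (B →ₗ[K] K) := (mB.mul.compr₂ φ).flip

@[simp] lemma form_apply (φ : B →ₗ[K] K) (n a : B) : form mB φ n a = φ (mB.mul a n) := rfl

lemma slR_form (φ : B →ₗ[K] K) (h : B) (z : A ⊗[K] B) :
    slR (φ ∘ₗ mB.mul h) z = slR (LinearMap.applyₗ h) ((form mB φ).lTensor A z) := by
  rw [slR_lTensor]; rfl

lemma lTensor_form_eq_zero {φ : B →ₗ[K] K} {z : A ⊗[K] B}
    (h : ∀ b, slR (φ ∘ₗ mB.mul b) z = 0) : (form mB φ).lTensor A z = 0 := by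
  refine eq_zero_of_slL fun ω => LinearMap.ext fun b => ?_
  have := apply_slR ω (LinearMap.applyₗ b) ((form mB φ).lTensor A z)
  rw [← slR_form, h, map_zero] at this
  exact this.symm

/-- If `φB(a n) = 0` for all `a`, then the second leg of `Δ n` has the same property. Here `r` is
the coaction `B → M(B ⊗ H)` and `l` the coaction `B → M(H ⊗ B)`. Invariance gives
`a₁ ⊗ a₂ n₁ y φH(a₃ n₂) = a₁ φB(a₂ n) ⊗ y = 0`, and the canonical maps can be cancelled. -/
lemma form_T₃_eq_zero {H : Type*} [AddCommGroup H] [Module K H] {mH : NDMul K H}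
    {l : Cop mB mH mB} {r : Cop mB mB mH} (hlr : Coassoc l r l r)
    {φB : B →ₗ[K] K} {φH : H →ₗ[K] K} (hφ : LeftInv r φB φH) {n : B}
    (hn : form mB φB n = 0) (y : B) : (form mH φH).lTensor B (r.T₃ n y) = 0 := by
  classical
  -- `S a (y ⊗ b) = (I ⊗ φH)(Δ(a)(1 ⊗ b)) ⊗ y`
  let S : B → B ⊗[K] H →ₗ[K] B ⊗[K] B := fun a =>
    (TensorProduct.comm K B B).toLinearMap ∘ₗ (slR φH ∘ₗ r.T₁ a).lTensor B
  have hS : ∀ c a z, (mH.mul c).rTensor B (TensorProduct.lift l.T₁ (S a z))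
      = (slR φH ∘ₗ r.L.flip z).lTensor H (l.T₂ c a) := by
    intro c a z
    induction z with
    | zero => simp
    | add x y hx hy =>
      simp only [map_add, hx, hy, LinearMap.comp_add, LinearMap.lTensor_add, LinearMap.add_apply]
    | tmul y b =>
      have h₁ : slR φH ∘ₗ r.L.flip (y ⊗ₜ b)
          = mB.mul.flip y ∘ₗ slR φH ∘ₗ r.T₁.flip b := by
        ext v
        simp only [LinearMap.comp_apply, LinearMap.flip_apply, r.L_T₁, slR_rTensor]
      have h₂ := congrArg ((slR φH).lTensor H) (hlr.c₂₁ c a b)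
      rw [lTensor_slR_assoc, slR_rTensor] at h₂
      simp only [S, LinearMap.comp_apply, LinearMap.lTensor_tmul, LinearEquiv.coe_coe,
        TensorProduct.comm_tmul, TensorProduct.lift.tmul]
      rw [l.T₁₂, h₂, h₁, LinearMap.lTensor_comp, LinearMap.lTensor_comp]
      rfl
  have hS0 : ∀ a, S a (r.T₃ n y) = 0 := by
    intro a
    apply l.T₁_bij.1
    rw [map_zero]
    refine eq_of_rTensor (f := fun c => mH.mul c) mH.left_cancel fun c => ?_
    have : slR φH ∘ₗ r.L.flip (r.T₃ n y) = 0 := by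
      ext v
      have : φB (mB.mul v n) = 0 := LinearMap.congr_fun hn v
      simp [← r.T₃_mul, hφ.T₃, this]
    rw [hS, this]
    simp
  -- Multiply the first leg with `c`; the elements `(c ⊗ 1)Δ(a)` span `B ⊗ H`.
  let q : B ⊗[K] H →ₗ[K] H →ₗ[K] B :=
    ((LinearMap.lTensorHom B ∘ₗ mH.mul.compr₂ φH).compr₂ (TensorProduct.rid K B).toLinearMap).flip
  have hq : ∀ h z, q z h = slR (φH ∘ₗ mH.mul h) z := fun h z => rfl
  have hqT : ∀ c a z, (q z).lTensor B (r.T₂ c a) = (mB.mul c).rTensor B (S a z) := by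
    intro c a z
    induction z with
    | zero => simp
    | add x y hx hy => simp only [map_add, hx, hy, LinearMap.lTensor_add, LinearMap.add_apply]
    | tmul y b =>
      have : ∀ w, (q (y ⊗ₜ b)).lTensor B w = slR φH ((mH.mul.flip b).lTensor B w) ⊗ₜ y := by
        intro w
        induction w with
        | zero => simp
        | add x y hx hy => simp only [map_add, hx, hy, TensorProduct.add_tmul]
        | tmul g h => simp [hq, TensorProduct.tmul_smul, TensorProduct.smul_tmul']
      rw [this, ← r.T₁₂, slR_rTensor]
      rfl
  have hq0 : ∀ w, (q (r.T₃ n y)).lTensor B w = 0 := by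
    intro w
    obtain ⟨w, rfl⟩ := r.T₂_bij.2 w
    induction w with
    | zero => simp
    | add x y hx hy => simp only [map_add, hx, hy, add_zero]
    | tmul c a => rw [TensorProduct.lift.tmul, hqT, hS0, map_zero]
  apply lTensor_form_eq_zero
  intro h
  by_contra hne
  have h0 := hq0 (slR (φH ∘ₗ mH.mul h) (r.T₃ n y) ⊗ₜ h)
  rw [LinearMap.lTensor_tmul, hq] at h0
  refine hne (tmul_right_cancel (K := K) hne (a' := 0) ?_)
  rw [h0, TensorProduct.zero_tmul]

/-- The converse of `form_T₃_eq_zero`: `φB(c n) y = (I ⊗ φH)(Δ(c)Δ(n)(y ⊗ 1))`. -/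
lemma form_eq_zero_of_T₃ {H : Type*} [AddCommGroup H] [Module K H] {mH : NDMul K H}
    {r : Cop mB mB mH} {φB : B →ₗ[K] K} {φH : H →ₗ[K] K} (hφ : LeftInv r φB φH) {n : B}
    (hn : ∀ y, (form mH φH).lTensor B (r.T₃ n y) = 0) : form mB φB n = 0 := by
  by_cases hB : ∀ y : B, y = 0
  · rw [hB n, map_zero]
  push Not at hB
  obtain ⟨y, hy⟩ := hB
  ext c
  -- `(I ⊗ φH)(Δ(c) z)` only depends on the image of `z` under `I ⊗ form`.
  let Q : B ⊗[K] (H →ₗ[K] K) →ₗ[K] B :=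
    TensorProduct.lift ((LinearMap.flip (LinearMap.lTensorHom B)).compr₂
        (TensorProduct.rid K B).toLinearMap ∘ₗ r.T₃ c)
  have hQ : ∀ z, slR φH (r.L c z) = Q ((form mH φH).lTensor B z) := by
    intro z
    induction z with
    | zero => simp
    | add x y hx hy => simp only [map_add, hx, hy]
    | tmul x h =>
      rw [r.L_T₃, slR_lTensor]
      rfl
  have := hQ (r.T₃ n y)
  rw [hn, map_zero, ← r.T₃_mul, hφ.T₃] at this
  simpa [hy] using this

end Invariance

section Faithful

variable {K H : Type*} [Field K] [AddCommGroup H] [Module K H] {mH : NDMul K H}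

/-- The slices `(I ⊗ φ)((1 ⊗ c)Δ(n))` of `Δ n`. -/
def Cop.slice₄ (D : Cop mH mH mH) (φ : H →ₗ[K] K) (c : H) : H →ₗ[K] H := slR φ ∘ₗ D.T₄ c

lemma Cop.mul_slice₄ (D : Cop mH mH mH) (φ : H →ₗ[K] K) (c n x : H) :
    mH.mul (D.slice₄ φ c n) x = slR (φ ∘ₗ mH.mul c) (D.T₃ n x) := by
  rw [← slR_lTensor, D.T₃₄, slR_rTensor]; rfl

lemma Coassoc.lift_T₂_slice₄ {D : Cop mH mH mH} (hD : Coassoc D D D D) (φ : H →ₗ[K] K) (c : H)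
    (w : H ⊗[K] H) : TensorProduct.lift D.T₂ ((D.slice₄ φ c).lTensor H w)
      = (D.slice₄ φ c).lTensor H (TensorProduct.lift D.T₂ w) := by
  induction w with
  | zero => simp
  | add x y hx hy => simp only [map_add, hx, hy]
  | tmul y n =>
    have h₂ := congrArg ((slR φ).lTensor H) (hD.c₂₄ y n c)
    rw [lTensor_slR_assoc, slR_rTensor, ← LinearMap.comp_apply ((slR φ).lTensor H),
      ← LinearMap.lTensor_comp] at h₂
    exact h₂

/-- The second leg of the preimage of `y ⊗ n` under `x ⊗ a ↦ (x ⊗ 1)Δ(a)` lies in the kernel of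
`form` whenever `n` does. -/
lemma form_eq_zero_of_lift_T₂ {D : Cop mH mH mH} (hD : Coassoc D D D D) {φ : H →ₗ[K] K}
    (hφ : LeftInv D φ φ) {n y : H} (hn : form mH φ n = 0) {w : H ⊗[K] H}
    (hw : TensorProduct.lift D.T₂ w = y ⊗ₜ n) : (form mH φ).lTensor H w = 0 := by
  have hY : ∀ c, D.slice₄ φ c n = 0 := fun c => mH.right_cancel _ fun x => by
    rw [D.mul_slice₄, slR_form, form_T₃_eq_zero hD hφ hn, map_zero]
  have hw0 : ∀ c, (D.slice₄ φ c).lTensor H w = 0 := fun c => by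
    apply D.T₂_bij.1
    rw [hD.lift_T₂_slice₄, hw, LinearMap.lTensor_tmul, hY, TensorProduct.tmul_zero, map_zero]
  refine eq_zero_of_slL fun ω => ?_
  rw [slL_lTensor]
  refine form_eq_zero_of_T₃ hφ fun x => lTensor_form_eq_zero fun c => ?_
  rw [← D.mul_slice₄, ← slL_lTensor, hw0]
  simp

/-- Existence of the counit `ε`. It is given by `∑ aᵢ bᵢ = ε(a) b` where
`a ⊗ b = ∑ Δ(aᵢ)(1 ⊗ bᵢ)`; coassociativity shows that the left hand side is a multiple of `b`. -/
lemma exists_counit {D : Cop mH mH mH} (hD : Coassoc D D D D) {ω : H →ₗ[K] K} (hω : ω ≠ 0) :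
    ∃ ε : H →ₗ[K] K, ∀ c a, slR ε (D.T₂ c a) = mH.mul c a := by
  obtain ⟨h₀, hh₀⟩ : ∃ h₀, ω h₀ = 1 := by
    obtain ⟨h, hh⟩ : ∃ h, ω h ≠ 0 := by
      by_contra! H
      exact hω (LinearMap.ext H)
    exact ⟨(ω h)⁻¹ • h, by simp [hh]⟩
  have hne : h₀ ≠ 0 := by rintro rfl; simp at hh₀
  let e₁ := LinearEquiv.ofBijective _ D.T₁_bij
  let e₂ := LinearEquiv.ofBijective _ D.T₂_bij
  let μ := TensorProduct.lift mH.mul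
  -- `E b a = ∑ aᵢ bᵢ` where `a ⊗ b = ∑ Δ(aᵢ)(1 ⊗ bᵢ)`
  let E : H → H →ₗ[K] H := fun b =>
    μ ∘ₗ e₁.symm.toLinearMap ∘ₗ (TensorProduct.mk K H H).flip b
  have key : ∀ c z, (μ ∘ₗ e₁.symm.toLinearMap).lTensor H
      (TensorProduct.assoc K H H H ((D.T₂ c).rTensor H z)) = (mH.mul c).rTensor H z := by
    intro c z
    obtain ⟨w, rfl⟩ := e₁.surjective z
    induction w with
    | zero => simp
    | add x y hx hy => simp only [map_add, hx, hy]
    | tmul u v =>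
      have h₁ : (μ ∘ₗ e₁.symm.toLinearMap) ∘ₗ D.T₁.flip v = mH.mul.flip v := by
        ext x
        have : e₁ (x ⊗ₜ v) = D.T₁ x v := rfl
        simp [← this, μ]
      change LinearMap.lTensor H _ (TensorProduct.assoc K H H H ((D.T₂ c).rTensor H (D.T₁ u v)))
        = (mH.mul c).rTensor H (D.T₁ u v)
      rw [hD.c₂₁, ← LinearMap.comp_apply, ← LinearMap.lTensor_comp, h₁, D.T₁₂]
  have hE : ∀ b c a, (E b).lTensor H (D.T₂ c a) = mH.mul c a ⊗ₜ b := by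
    intro b c a
    have := key c (a ⊗ₜ b)
    rw [LinearMap.rTensor_tmul, LinearMap.rTensor_tmul] at this
    rw [← this]
    generalize D.T₂ c a = t
    induction t with
    | zero => simp
    | add x y hx hy => simp only [map_add, hx, hy, TensorProduct.add_tmul]
    | tmul x y => simp [E]
  let ε : H →ₗ[K] K := ω ∘ₗ μ ∘ₗ e₂.symm.toLinearMap ∘ₗ TensorProduct.mk K H H h₀
  -- Slicing `hE` shows that `E b a` is a multiple of `b`.
  have hEω : ∀ b w, E b (slL ω (e₂ w)) = ω (μ w) • b := by
    intro b w
    induction w with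
    | zero => simp
    | add x y hx hy => simp only [map_add, hx, hy, add_smul]
    | tmul c a =>
      have : e₂ (c ⊗ₜ a) = D.T₂ c a := rfl
      rw [this, ← slL_lTensor, hE, slL_tmul]
      rfl
  have hEε : ∀ b a, E b a = ε a • b := by
    intro b a
    have := hEω b (e₂.symm (h₀ ⊗ₜ a))
    rw [LinearEquiv.apply_symm_apply, slL_tmul, hh₀, one_smul] at this
    exact this
  refine ⟨ε, fun c a => tmul_right_cancel (K := K) hne ?_⟩
  rw [← hE]
  generalize D.T₂ c a = t
  induction t with
  | zero => simp
  | add x y hx hy => simp only [map_add, hx, hy, TensorProduct.add_tmul]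
  | tmul x y => simp [hEε, TensorProduct.smul_tmul']

/-- A nonzero left invariant functional on `H` is faithful on one side. -/
lemma form_injective {D : Cop mH mH mH} (hD : Coassoc D D D D) {φ : H →ₗ[K] K}
    (hφ : LeftInv D φ φ) (h0 : φ ≠ 0) {n : H} (hn : form mH φ n = 0) : n = 0 := by
  obtain ⟨ε, hε⟩ := exists_counit hD h0
  have hμ : ∀ w, slR ε (TensorProduct.lift D.T₂ w) = TensorProduct.lift mH.mul w := by
    intro w
    induction w with
    | zero => simp
    | add x y hx hy => simp only [map_add, hx, hy]
    | tmul c a => exact hε c a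
  have hker : ∀ n, form mH φ n = 0 → ε n = 0 := by
    intro n hn
    by_contra hne
    apply h0
    -- otherwise every `y` is a multiple of `∑ yᵢ nᵢ`, where `y ⊗ n = ∑ (yᵢ ⊗ 1)Δ(nᵢ)`
    ext y
    obtain ⟨w, hw⟩ := D.T₂_bij.2 (y ⊗ₜ n)
    have hw0 := form_eq_zero_of_lift_T₂ hD hφ hn hw
    have h₁ : φ (TensorProduct.lift mH.mul w)
        = TensorProduct.lift LinearMap.applyₗ ((form mH φ).lTensor H w) := by
      clear hw hw0
      induction w with
      | zero => simp
      | add x y hx hy => simp only [map_add, hx, hy]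
      | tmul c a => simp
    rw [hw0, map_zero, ← hμ, hw, slR_tmul, map_smul, smul_eq_mul] at h₁
    simpa [hne] using h₁
  have hN : ∀ x, (form mH φ).lTensor H (D.T₃ n x) = 0 := form_T₃_eq_zero hD hφ hn
  refine mH.left_cancel _ fun c => mH.right_cancel _ fun x => ?_
  -- `c n x = (I ⊗ ε)((c ⊗ 1)Δ(n)(x ⊗ 1))`
  have h₁ : mH.mul (mH.mul c n) x = slR ε ((mH.mul.flip x).rTensor H (D.T₂ c n)) := by
    rw [slR_rTensor, hε]; rfl
  rw [h₁, ← D.T₂₃, slR_rTensor]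
  refine (congrArg (mH.mul c) ?_).trans (map_zero _)
  refine (Module.forall_dual_apply_eq_zero_iff K _).1 fun ω => ?_
  rw [apply_slR]
  apply hker
  rw [← slL_lTensor, hN, map_zero]

end Faithful

/-! ### Uniqueness, and passage from `H` to its comodules -/

section Uniqueness

variable {K H : Type*} [Field K] [AddCommGroup H] [Module K H] {mH : NDMul K H}

/-- `∑ (I ⊗ φ')((1 ⊗ Xᵢ)Δ(dᵢ)) = φ'(f) (I ⊗ φ)((1 ⊗ a)Δ(b))`, where `∑ dᵢ ⊗ bᵢ = Δ(b)(f ⊗ 1)` and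
`Xᵢ = (I ⊗ φ)(Δ(a)(1 ⊗ bᵢ))`. -/
lemma slice₄_slR_T₁ {D : Cop mH mH mH} (hD : Coassoc D D D D) {φ φ' : H →ₗ[K] K}
    (hφ : LeftInv D φ φ) (hφ' : LeftInv D φ' φ') (a b f : H) :
    TensorProduct.lift ((D.T₄.compr₂ (slR φ')).compl₁₂ (slR φ ∘ₗ D.T₁ a) LinearMap.id).flip
      (D.T₃ b f) = φ' f • D.slice₄ φ a b := by
  set F := TensorProduct.lift
    ((D.T₄.compr₂ (slR φ')).compl₁₂ (slR φ ∘ₗ D.T₁ a) LinearMap.id).flip with hF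
  rw [← sub_eq_zero]
  refine mH.right_cancel _ fun e => ?_
  rw [map_sub, LinearMap.sub_apply, sub_eq_zero]
  have h₁ : ∀ z, mH.mul (F z) e = slR φ' ((slR φ ∘ₗ D.L a).lTensor H
      (TensorProduct.assoc K H H H ((D.T₃.flip e).rTensor H z))) := by
    intro z
    induction z with
    | zero => simp
    | add x y hx hy => simp only [map_add, hx, hy, LinearMap.add_apply]
    | tmul d b =>
      have : mH.mul (F (d ⊗ₜ b)) e = slR φ' ((mH.mul (slR φ (D.T₁ a b))).lTensor H (D.T₃ d e)) := by
        rw [D.T₃₄, slR_rTensor]; rfl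
      rw [this, LinearMap.rTensor_tmul, LinearMap.flip_apply]
      generalize D.T₃ d e = t
      induction t with
      | zero => simp
      | add x y hx hy => simp only [map_add, hx, hy, TensorProduct.add_tmul]
      | tmul g k =>
        simp [D.L_T₁, slR_rTensor]
  have h₂ : ∀ z, slR φ' ((slR φ ∘ₗ D.L a).lTensor H (D.comul₂ b z))
      = mH.mul (D.slice₄ φ a b) (slR φ' z) := by
    intro z
    induction z with
    | zero => simp
    | add x y hx hy => simp only [map_add, hx, hy]
    | tmul e' f' =>
      have h₃ : φ' ∘ₗ (slR φ ∘ₗ D.L a) ∘ₗ D.T₃.flip f' = φ' f' • (φ ∘ₗ mH.mul a) := by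
        ext v
        simp [← D.T₃_mul, hφ.T₃, mul_comm]
      rw [Cop.comul₂_tmul, slR_lTensor, slR_lTensor, LinearMap.comp_assoc, h₃, slR_smul,
        ← D.mul_slice₄, slR_tmul, map_smul]
  rw [h₁, ← hD.comul₂_T₃, h₂, hφ'.T₃]
  simp

/-- `∑ φ(Y bᵢ) dᵢ = φ(Y b) f`, where `∑ dᵢ ⊗ bᵢ = Δ(b)(f ⊗ 1)` and
`Y b = (I ⊗ φ)((1 ⊗ a)Δ(b))`. -/
lemma slR_slice₄_T₃ {D : Cop mH mH mH} (hD : Coassoc D D D D) {φ : H →ₗ[K] K}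
    (hφ : LeftInv D φ φ) (a b f : H) :
    slR (φ ∘ₗ D.slice₄ φ a) (D.T₃ b f) = φ (D.slice₄ φ a b) • f := by
  have h₁ : slR φ ∘ₗ D.T₃.flip f = φ.smulRight f := by
    ext v; simp [hφ.T₃]
  rw [Cop.slice₄, ← LinearMap.comp_assoc, ← slR_lTensor, ← hD.c₃₄, slR_slR_assoc,
    slR_rTensor, slR_rTensor, ← LinearMap.comp_apply (slR φ), h₁]
  rfl

/-- The identity `φ(d₁) φ'(X d₂) = φ(Y) φ'(d)` for `X = (I ⊗ φ)(Δ(a)(1 ⊗ b))` and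
`Y = (I ⊗ φ)((1 ⊗ a)Δ(b))`, that is, `Y = S(X)` for the antipode `S`. -/
lemma apply_slR_T₄ {D : Cop mH mH mH} (hD : Coassoc D D D D) {φ φ' : H →ₗ[K] K}
    (hφ : LeftInv D φ φ) (hφ' : LeftInv D φ' φ') (a b d : H) :
    φ (slR φ' (D.T₄ (slR φ (D.T₁ a b)) d)) = φ (D.slice₄ φ a b) * φ' d := by
  have key : ∀ z, φ (TensorProduct.lift ((D.T₄.compr₂ (slR φ')).compl₁₂ (slR φ ∘ₗ D.T₁ a)
      LinearMap.id).flip z) = φ' (slR (φ ∘ₗ D.slice₄ φ a) z) := by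
    intro z
    obtain ⟨w, rfl⟩ := D.T₃_bij.2 z
    induction w with
    | zero => simp
    | add x y hx hy => simp only [map_add, hx, hy]
    | tmul b f =>
      rw [TensorProduct.lift.tmul, slice₄_slR_T₁ hD hφ hφ', slR_slice₄_T₃ hD hφ]
      simp [mul_comm]
  simpa using key (d ⊗ₜ b)

/-- Left invariant functionals on `H` are unique up to a scalar. -/
lemma exists_eq_smul {D : Cop mH mH mH} (hD : Coassoc D D D D) {φ φ' : H →ₗ[K] K}
    (hφ : LeftInv D φ φ) (h0 : φ ≠ 0) (hφ' : LeftInv D φ' φ') : ∃ c : K, φ' = c • φ := by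
  obtain ⟨h₀, hh₀⟩ : ∃ h₀, φ h₀ ≠ 0 := by
    by_contra! H
    exact h0 (LinearMap.ext H)
  -- The maps `a ⊗ b ↦ X` and `a ⊗ b ↦ Y` are onto.
  have hspan : ∀ (T : H ⊗[K] H →ₗ[K] H ⊗[K] H), Function.Surjective T →
      Function.Surjective (slR φ ∘ₗ T) := by
    intro T hT x
    obtain ⟨w, hw⟩ := hT (x ⊗ₜ h₀)
    exact ⟨(φ h₀)⁻¹ • w, by simp [hw, hh₀]⟩
  have hker : ∀ d, φ d = 0 → φ' d = 0 := by
    intro d hd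
    have h₁ : ∀ x, φ (slR φ (D.T₄ x d)) = 0 := by
      intro x
      obtain ⟨w, rfl⟩ := hspan _ D.T₁_bij.2 x
      induction w with
      | zero => simp
      | add x y hx hy => simp only [map_add, LinearMap.add_apply, hx, hy, add_zero]
      | tmul a b => simpa [hd] using apply_slR_T₄ hD hφ hφ a b d
    have h₂ : ∀ c, slL φ (D.T₄ c d) = 0 := by
      intro c
      refine form_injective hD hφ h0 (LinearMap.ext fun x => ?_)
      rw [form_apply, ← slL_lTensor, ← D.T₄_left, ← apply_slR, h₁]
      rfl
    obtain ⟨w, hw⟩ := hspan _ D.T₄_bij.2 h₀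
    by_contra hne
    apply hh₀
    rw [← hw]
    clear hw
    induction w with
    | zero => simp
    | add x y hx hy => simp only [map_add, hx, hy, add_zero]
    | tmul a b =>
      have := apply_slR_T₄ hD hφ hφ' a b d
      rw [apply_slR, h₂, map_zero, eq_comm, mul_eq_zero] at this
      exact this.resolve_right hne
  refine ⟨φ' h₀ / φ h₀, LinearMap.ext fun d => ?_⟩
  have := hker (d - (φ d / φ h₀) • h₀) (by simp [hh₀])
  rw [map_sub, sub_eq_zero] at this
  rw [this]
  simp only [map_smul, LinearMap.smul_apply, smul_eq_mul]
  ring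

end Uniqueness

section Bicomodule

variable {K H B : Type*} [Field K] [AddCommGroup H] [Module K H] [AddCommGroup B] [Module K B]
  {mH : NDMul K H} {mB : NDMul K B}

/-- If the functional `φB` on a comodule `B` of `H` does not vanish, neither does `φH`. -/
lemma LeftInv.ne_zero {r : Cop mB mB mH} {φB : B →ₗ[K] K} {φH : H →ₗ[K] K}
    (h : LeftInv r φB φH) (h0 : φB ≠ 0) : φH ≠ 0 := by
  rintro rfl
  refine h0 (LinearMap.ext fun a => ?_)
  by_contra hne
  have h₁ := h.T₃ a a
  rw [slR, LinearMap.lTensor_zero, LinearMap.comp_zero, LinearMap.zero_apply, eq_comm,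
    smul_eq_zero] at h₁
  rcases h₁ with h₁ | rfl
  · exact hne h₁
  · simp at hne

/-- Faithfulness on one side for a comodule `B`: the second leg of `Δ n` lies in the kernel of
`form`, which is trivial on `H`. -/
lemma eq_zero_of_forall_apply_mul {D : Cop mH mH mH} (hD : Coassoc D D D D)
    {l : Cop mB mH mB} {r : Cop mB mB mH} (hlr : Coassoc l r l r) {φB : B →ₗ[K] K}
    {φH : H →ₗ[K] K} (hφH : LeftInv D φH φH) (hφB : LeftInv r φB φH) (h0 : φH ≠ 0) {n : B}
    (hn : ∀ a, φB (mB.mul a n) = 0) : n = 0 := by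
  have h₁ : r.T₃ n n = 0 := by
    refine eq_zero_of_slL fun ω => form_injective hD hφH h0 ?_
    rw [← slL_lTensor, form_T₃_eq_zero hlr hφB (LinearMap.ext hn), map_zero]
  have h₂ : n ⊗ₜ[K] n = 0 := r.T₃_bij.1 (by rw [map_zero, TensorProduct.lift.tmul, h₁])
  by_contra hne
  exact hne (tmul_right_cancel (K := K) hne (h₂.trans (TensorProduct.zero_tmul _ _).symm))

/-- Scalar multiples propagate from `H` to its comodules. -/
lemma LeftInv.eq_smul {r : Cop mB mB mH} {φB φB' : B →ₗ[K] K} {φH : H →ₗ[K] K} {c : K}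
    (h : LeftInv r φB φH) (h' : LeftInv r φB' (c • φH)) : φB' = c • φB := by
  ext a
  by_cases ha : a = 0
  · simp [ha]
  have h₁ : φB' a • a = (c • φB) a • a := by
    rw [← h'.T₃, LinearMap.smul_apply, smul_assoc, ← h.T₃, slR_smul]
  exact smul_left_injective K ha h₁

end Bicomodule

/-! ### Covered versions of a comultiplication with values in multipliers -/

section Elements

variable {A : Type*} [NonUnitalRing A] [Module ℂ A] [IsScalarTower ℂ A A] [SMulCommClass ℂ A A]
variable {B : Type*} [NonUnitalRing B] [Module ℂ B] [IsScalarTower ℂ B B] [SMulCommClass ℂ B B]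
variable {C : Type*} [NonUnitalRing C] [Module ℂ C] [IsScalarTower ℂ C C] [SMulCommClass ℂ C C]

/-- The product of a nondegenerate algebra. -/
@[simps] def HasNondegenerateProduct.ndMul (h : HasNondegenerateProduct A) : NDMul ℂ A where
  mul := LinearMap.mul ℂ A
  assoc := mul_assoc
  left_cancel := h.1
  right_cancel := h.2

lemma mul_tmul_eq (z : A ⊗[ℂ] B) (a : A) (b : B) : z * a ⊗ₜ b
    = ((LinearMap.mul ℂ B).flip b).lTensor A (((LinearMap.mul ℂ A).flip a).rTensor B z) := by
  induction z with
  | zero => simp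
  | add x y hx hy => simp only [map_add, add_mul, hx, hy]
  | tmul x y => simp [Algebra.TensorProduct.tmul_mul_tmul]

lemma tensor_right_cancel (hA : ∀ a : A, (∀ b, a * b = 0) → a = 0)
    (hB : ∀ a : B, (∀ b, a * b = 0) → a = 0) (z : A ⊗[ℂ] B) (h : ∀ w, z * w = 0) : z = 0 := by
  refine eq_of_rTensor (f := fun a => (LinearMap.mul ℂ A).flip a) hA fun a => ?_
  refine eq_of_lTensor (f := fun b => (LinearMap.mul ℂ B).flip b) hB fun b => ?_
  rw [← mul_tmul_eq, h, map_zero, map_zero]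

lemma ofElem_injective (hA : ∀ a : A, (∀ b, a * b = 0) → a = 0) :
    Function.Injective (ofElem (A := A)) := by
  refine (injective_iff_map_eq_zero _).2 fun a ha => hA a fun b => ?_
  have : (ofElem a).left b = (0 : Multiplier A).left b := by rw [ha]
  exact this

lemma ofElem_tmul_injective (hA : HasNondegenerateProduct A) (hB : HasNondegenerateProduct B) :
    Function.Injective (ofElem (A := A ⊗[ℂ] B)) :=
  ofElem_injective (tensor_right_cancel hA.2 hB.2)

lemma ofElem_mul (a b : A) : ofElem (a * b) = ofElem a * ofElem b :=
  Multiplier.ext' (fun _ => mul_assoc _ _ _) (fun _ => (mul_assoc _ _ _).symm)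

lemma ofElem_left (m : Multiplier A) (a : A) : ofElem (m.left a) = m * ofElem a :=
  Multiplier.ext' (fun _ => (m.left_mul _ _).symm) (fun _ => (m.right_mul_left _ _).symm)

lemma ofElem_right (m : Multiplier A) (a : A) : ofElem (m.right a) = ofElem a * m :=
  Multiplier.ext' (fun _ => m.right_mul_left _ _) (fun _ => (m.right_mul _ _).symm)

lemma tmulMultiplier_mul (m m' : Multiplier A) (n n' : Multiplier B) :
    tmulMultiplier m n * tmulMultiplier m' n' = tmulMultiplier (m * m') (n * n') := by
  have h : ∀ (f f' : A →ₗ[ℂ] A) (g g' : B →ₗ[ℂ] B) (z : A ⊗[ℂ] B),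
      TensorProduct.map f g (TensorProduct.map f' g' z)
        = TensorProduct.map (f ∘ₗ f') (g ∘ₗ g') z := by
    intro f f' g g' z
    rw [TensorProduct.map_comp, LinearMap.comp_apply]
  exact Multiplier.ext' (fun z => h m.left m'.left n.left n'.left z)
    (fun z => h m'.right m.right n'.right n.right z)

lemma ofElem_tmul (a : A) (b : B) : ofElem (a ⊗ₜ[ℂ] b) = tmulMultiplier (ofElem a) (ofElem b) := by
  refine Multiplier.ext' (fun z => ?_) (fun z => ?_)
  · change a ⊗ₜ[ℂ] b * z = TensorProduct.map (LinearMap.mulLeft ℂ a) (LinearMap.mulLeft ℂ b) z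
    induction z with
    | zero => simp
    | add x y hx hy => simp only [map_add, mul_add, hx, hy]
    | tmul x y => simp [Algebra.TensorProduct.tmul_mul_tmul]
  · change z * a ⊗ₜ[ℂ] b = TensorProduct.map (LinearMap.mulRight ℂ a) (LinearMap.mulRight ℂ b) z
    induction z with
    | zero => simp
    | add x y hx hy => simp only [map_add, add_mul, hx, hy]
    | tmul x y => simp [Algebra.TensorProduct.tmul_mul_tmul]

lemma tmulOne_mul_oneTmul (a : A) (b : B) : tmulOne B a * oneTmul A b = ofElem (a ⊗ₜ[ℂ] b) := by
  rw [tmulOne, oneTmul, tmulMultiplier_mul, one_mul, mul_one, ofElem_tmul]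

lemma oneTmul_mul_tmulOne (a : A) (b : B) : oneTmul A b * tmulOne B a = ofElem (a ⊗ₜ[ℂ] b) := by
  rw [tmulOne, oneTmul, tmulMultiplier_mul, one_mul, mul_one, ofElem_tmul]

lemma tmulOne_mul (a a' : A) : tmulOne B (a * a') = tmulOne B a * tmulOne B a' := by
  rw [tmulOne, tmulOne, tmulOne, tmulMultiplier_mul, one_mul, ofElem_mul]

lemma oneTmul_mul (b b' : B) : oneTmul A (b * b') = oneTmul A b * oneTmul A b' := by
  rw [oneTmul, oneTmul, oneTmul, tmulMultiplier_mul, one_mul, ofElem_mul]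

lemma ofElem_rTensor_mul (a : A) (z : A ⊗[ℂ] B) :
    ofElem ((LinearMap.mul ℂ A a).rTensor B z) = tmulOne B a * ofElem z := by
  induction z with
  | zero => simp
  | add x y hx hy => simp only [map_add, mul_add, hx, hy]
  | tmul x y => simp [ofElem_tmul, tmulOne, tmulMultiplier_mul, ofElem_mul]

lemma ofElem_lTensor_mul (b : B) (z : A ⊗[ℂ] B) :
    ofElem ((LinearMap.mul ℂ B b).lTensor A z) = oneTmul A b * ofElem z := by
  induction z with
  | zero => simp
  | add x y hx hy => simp only [map_add, mul_add, hx, hy]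
  | tmul x y => simp [ofElem_tmul, oneTmul, tmulMultiplier_mul, ofElem_mul]

lemma ofElem_rTensor_mul_flip (a : A) (z : A ⊗[ℂ] B) :
    ofElem (((LinearMap.mul ℂ A).flip a).rTensor B z) = ofElem z * tmulOne B a := by
  induction z with
  | zero => simp
  | add x y hx hy => simp only [map_add, add_mul, hx, hy]
  | tmul x y => simp [ofElem_tmul, tmulOne, tmulMultiplier_mul, ofElem_mul]

lemma ofElem_lTensor_mul_flip (b : B) (z : A ⊗[ℂ] B) :
    ofElem (((LinearMap.mul ℂ B).flip b).lTensor A z) = ofElem z * oneTmul A b := by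
  induction z with
  | zero => simp
  | add x y hx hy => simp only [map_add, add_mul, hx, hy]
  | tmul x y => simp [ofElem_tmul, oneTmul, tmulMultiplier_mul, ofElem_mul]

lemma flip_mul (m n : Multiplier (A ⊗[ℂ] B)) : flip (m * n) = flip m * flip n := by
  refine Multiplier.ext' (fun z => ?_) (fun z => ?_)
  · change TensorProduct.comm ℂ A B (m.left (n.left _)) = TensorProduct.comm ℂ A B (m.left
      ((TensorProduct.comm ℂ A B).symm (TensorProduct.comm ℂ A B (n.left _))))
    rw [LinearEquiv.symm_apply_apply]
  · change TensorProduct.comm ℂ A B (n.right (m.right _)) = TensorProduct.comm ℂ A B (n.right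
      ((TensorProduct.comm ℂ A B).symm (TensorProduct.comm ℂ A B (m.right _))))
    rw [LinearEquiv.symm_apply_apply]

lemma flip_flip (m : Multiplier (A ⊗[ℂ] B)) : flip (flip m) = m := by
  have h : ∀ z : A ⊗[ℂ] B, (TensorProduct.comm ℂ B A) ((TensorProduct.comm ℂ A B) z) = z :=
    fun z => (TensorProduct.comm ℂ A B).symm_apply_apply z
  refine Multiplier.ext' (fun z => ?_) (fun z => ?_)
  · exact (h _).trans (congrArg m.left (h z))
  · exact (h _).trans (congrArg m.right (h z))

lemma flip_ofElem (z : A ⊗[ℂ] B) : flip (ofElem z) = ofElem (TensorProduct.comm ℂ A B z) := by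
  refine Multiplier.ext' (fun w => ?_) (fun w => ?_)
  · change TensorProduct.comm ℂ A B (z * (TensorProduct.comm ℂ A B).symm w)
      = TensorProduct.comm ℂ A B z * w
    rw [comm_mul, LinearEquiv.apply_symm_apply]
  · change TensorProduct.comm ℂ A B ((TensorProduct.comm ℂ A B).symm w * z)
      = w * TensorProduct.comm ℂ A B z
    rw [comm_mul, LinearEquiv.apply_symm_apply]

lemma flip_tmulMultiplier (m : Multiplier A) (n : Multiplier B) :
    flip (tmulMultiplier m n) = tmulMultiplier n m := by
  have h : ∀ (f : A →ₗ[ℂ] A) (g : B →ₗ[ℂ] B) (z : B ⊗[ℂ] A), TensorProduct.comm ℂ A B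
      (TensorProduct.map f g ((TensorProduct.comm ℂ A B).symm z)) = TensorProduct.map g f z := by
    intro f g z
    induction z with
    | zero => simp
    | add x y hx hy => simp only [map_add, hx, hy]
    | tmul x y => simp
  exact Multiplier.ext' (fun z => h _ _ z) (fun z => h _ _ z)

/-- A bijection onto the image of `A` in `M(A)` lifts to `A`. -/
lemma exists_lift_ofElem (hA : Function.Injective (ofElem (A := A))) {X : Type*} [AddCommGroup X]
    [Module ℂ X] (F : X →ₗ[ℂ] Multiplier A) (hF : Set.BijOn F Set.univ (Set.range (ofElem (A := A)))) :
    ∃ f : X →ₗ[ℂ] A, Function.Bijective f ∧ ∀ x, ofElem (f x) = F x := by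
  let e := LinearEquiv.ofInjective (ofElem (A := A)) hA
  let f : X →ₗ[ℂ] A := e.symm.toLinearMap ∘ₗ
    F.codRestrict (LinearMap.range (ofElem (A := A))) (fun x => hF.1 (Set.mem_univ x))
  have hf : ∀ x, ofElem (f x) = F x := by
    intro x
    have : (e (f x) : Multiplier A) = F x := by
      simp only [f, LinearMap.comp_apply, LinearEquiv.coe_coe, LinearEquiv.apply_symm_apply]
      rfl
    exact this
  refine ⟨f, ⟨fun x y h => ?_, fun a => ?_⟩, hf⟩
  · exact hF.2.1 (Set.mem_univ _) (Set.mem_univ _) (by rw [← hf, ← hf, h])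
  · obtain ⟨x, -, hx⟩ := hF.2.2 ⟨a, rfl⟩
    exact ⟨x, hA (by rw [hf, hx])⟩

end Elements

section Realize

variable {A : Type*} [NonUnitalRing A] [Module ℂ A] [IsScalarTower ℂ A A] [SMulCommClass ℂ A A]
variable {B : Type*} [NonUnitalRing B] [Module ℂ B] [IsScalarTower ℂ B B] [SMulCommClass ℂ B B]
variable {C : Type*} [NonUnitalRing C] [Module ℂ C] [IsScalarTower ℂ C C] [SMulCommClass ℂ C C]
variable {U : Type*} [NonUnitalRing U] [Module ℂ U] [IsScalarTower ℂ U U] [SMulCommClass ℂ U U]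
variable {V : Type*} [NonUnitalRing V] [Module ℂ V] [IsScalarTower ℂ V V] [SMulCommClass ℂ V V]
variable {W : Type*} [NonUnitalRing W] [Module ℂ W] [IsScalarTower ℂ W W] [SMulCommClass ℂ W W]

/-- The maps of `E` are the covered versions of the comultiplication `D : U → M(A ⊗ B)`. -/
structure Cop.Realizes {mU : NDMul ℂ U} {mA : NDMul ℂ A} {mB : NDMul ℂ B} (E : Cop mU mA mB)
    (D : U →ₗ[ℂ] Multiplier (A ⊗[ℂ] B)) : Prop where
  T₁ : ∀ a y, ofElem (E.T₁ a y) = D a * oneTmul A y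
  T₂ : ∀ x a, ofElem (E.T₂ x a) = tmulOne B x * D a
  T₃ : ∀ a x, ofElem (E.T₃ a x) = D a * tmulOne B x
  T₄ : ∀ y a, ofElem (E.T₄ y a) = oneTmul A y * D a

lemma exists_realizes (hU : HasNondegenerateProduct U) (hA : HasNondegenerateProduct A)
    (hB : HasNondegenerateProduct B) (D : U →ₗ[ℂ] Multiplier (A ⊗[ℂ] B))
    (hD : ∀ a b, D (a * b) = D a * D b) (hbij : HasBijectiveCanonicalMaps D)
    (hbij' : HasBijectiveCanonicalMaps (flip ∘ₗ D)) :
    ∃ E : Cop hU.ndMul hA.ndMul hB.ndMul, E.Realizes D := by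
  have inj := ofElem_tmul_injective hA hB
  obtain ⟨f₁, hf₁, h₁⟩ := exists_lift_ofElem inj _ hbij.1
  obtain ⟨f₂, hf₂, h₂⟩ := exists_lift_ofElem inj _ hbij.2
  obtain ⟨f₃, hf₃, h₃⟩ := exists_lift_ofElem (ofElem_tmul_injective hB hA) _ hbij'.1
  obtain ⟨f₄, hf₄, h₄⟩ := exists_lift_ofElem (ofElem_tmul_injective hB hA) _ hbij'.2
  let T₁ : U →ₗ[ℂ] B →ₗ[ℂ] A ⊗[ℂ] B := TensorProduct.curry f₁
  let T₂ : A →ₗ[ℂ] U →ₗ[ℂ] A ⊗[ℂ] B := TensorProduct.curry f₂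
  let T₃ : U →ₗ[ℂ] A →ₗ[ℂ] A ⊗[ℂ] B :=
    (TensorProduct.curry f₃).compr₂ (TensorProduct.comm ℂ B A).toLinearMap
  let T₄ : B →ₗ[ℂ] U →ₗ[ℂ] A ⊗[ℂ] B :=
    (TensorProduct.curry f₄).compr₂ (TensorProduct.comm ℂ B A).toLinearMap
  have e₁ : ∀ a y, ofElem (T₁ a y) = D a * oneTmul A y := fun a y => h₁ (a ⊗ₜ y)
  have e₂ : ∀ x a, ofElem (T₂ x a) = tmulOne B x * D a := fun x a => h₂ (x ⊗ₜ a)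
  have e₃ : ∀ a x, ofElem (T₃ a x) = D a * tmulOne B x := fun a x => by
    have h := congrArg flip (h₃ (a ⊗ₜ x))
    rw [flip_ofElem, T₁_tmul, flip_mul, LinearMap.comp_apply, flip_flip, oneTmul,
      flip_tmulMultiplier] at h
    exact h
  have e₄ : ∀ y a, ofElem (T₄ y a) = oneTmul A y * D a := fun y a => by
    have h := congrArg flip (h₄ (y ⊗ₜ a))
    rw [flip_ofElem, T₂_tmul, flip_mul, LinearMap.comp_apply, flip_flip, tmulOne,
      flip_tmulMultiplier] at h
    exact h
  let L : U →ₗ[ℂ] (A ⊗[ℂ] B →ₗ[ℂ] A ⊗[ℂ] B) :=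
    { toFun := fun a => (D a).left
      map_add' := fun a b => by rw [map_add]; rfl
      map_smul' := fun c a => by rw [map_smul]; rfl }
  let R : U →ₗ[ℂ] (A ⊗[ℂ] B →ₗ[ℂ] A ⊗[ℂ] B) :=
    { toFun := fun a => (D a).right
      map_add' := fun a b => by rw [map_add]; rfl
      map_smul' := fun c a => by rw [map_smul]; rfl }
  have eL : ∀ a z, ofElem (L a z) = D a * ofElem z := fun a z => ofElem_left _ _
  have eR : ∀ a z, ofElem (R a z) = ofElem z * D a := fun a z => ofElem_right _ _
  refine ⟨
    { T₁ := T₁, T₂ := T₂, T₃ := T₃, T₄ := T₄, L := L, R := R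
      T₁_bij := by
        have : TensorProduct.lift T₁ = f₁ := TensorProduct.ext' fun _ _ => rfl
        rwa [this]
      T₂_bij := by
        have : TensorProduct.lift T₂ = f₂ := TensorProduct.ext' fun _ _ => rfl
        rwa [this]
      T₃_bij := bijective_lift_compr₂ (by
        rwa [show TensorProduct.lift (TensorProduct.curry f₃) = f₃ from
          TensorProduct.ext' fun _ _ => rfl]) _
      T₄_bij := bijective_lift_compr₂ (by
        rwa [show TensorProduct.lift (TensorProduct.curry f₄) = f₄ from
          TensorProduct.ext' fun _ _ => rfl]) _
      T₁₂ := fun x a y => inj ?_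
      T₃₄ := fun y a x => inj ?_
      T₁₄ := fun y a y' => inj ?_
      T₂₃ := fun x a x' => inj ?_
      L_T₁ := fun a x y => inj ?_
      L_T₃ := fun a x y => inj ?_
      R_T₂ := fun a x y => inj ?_
      R_T₄ := fun a x y => inj ?_
      T₁_mul := fun a a' y => inj ?_
      T₃_mul := fun a a' x => inj ?_
      T₂_mul := fun x a a' => inj ?_
      T₄_mul := fun y a a' => inj ?_
      T₁_right := fun a y y' => inj ?_
      T₃_right := fun a x x' => inj ?_
      T₂_left := fun x x' a => inj ?_
      T₄_left := fun y y' a => inj ?_ }, ⟨e₁, e₂, e₃, e₄⟩⟩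
  all_goals simp only [HasNondegenerateProduct.ndMul_mul, ofElem_rTensor_mul, ofElem_lTensor_mul,
    ofElem_rTensor_mul_flip, ofElem_lTensor_mul_flip, eL, eR, e₁, e₂, e₃, e₄,
    LinearMap.mul_apply', hD, tmulOne_mul, oneTmul_mul, mul_assoc]
  · rw [oneTmul_mul_tmulOne]
  · rw [tmulOne_mul_oneTmul]
  · rw [← mul_assoc, oneTmul_mul_tmulOne]
  · rw [← mul_assoc, tmulOne_mul_oneTmul]

lemma assoc_eq_of_coassocIdentity (hA : HasNondegenerateProduct A)
    (hB : HasNondegenerateProduct B) (hC : HasNondegenerateProduct C)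
    {d : Multiplier (U ⊗[ℂ] C)} {D : U →ₗ[ℂ] Multiplier (A ⊗[ℂ] B)}
    {d' : Multiplier (A ⊗[ℂ] V)} {D' : V →ₗ[ℂ] Multiplier (B ⊗[ℂ] C)}
    (h : CoassocIdentity d D d' D') {a : A} {c : C} {f : U →ₗ[ℂ] A ⊗[ℂ] B} {g : V →ₗ[ℂ] B ⊗[ℂ] C}
    {x : U ⊗[ℂ] C} {y : A ⊗[ℂ] V} (hf : ∀ u, ofElem (f u) = tmulOne B a * D u)
    (hg : ∀ v, ofElem (g v) = D' v * oneTmul B c) (hx : ofElem x = d * oneTmul U c)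
    (hy : ofElem y = tmulOne V a * d') :
    TensorProduct.assoc ℂ A B C (f.rTensor C x) = g.lTensor A y := by
  have inj : Function.Injective (ofElem (A := A ⊗[ℂ] (B ⊗[ℂ] C))) :=
    ofElem_injective (tensor_right_cancel hA.2 (tensor_right_cancel hB.2 hC.2))
  apply inj
  have h₁ : ∀ x : U ⊗[ℂ] C, tmulMultiplier (tmulOne B a) 1 *
      tensorMultiplier (TensorProduct.map D ofElem x) = ofElem (f.rTensor C x) := by
    intro x
    induction x with
    | zero => simp
    | add x y hx hy => simp only [map_add, mul_add, hx, hy]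
    | tmul u c =>
      rw [LinearMap.rTensor_tmul, ofElem_tmul, hf, TensorProduct.map_tmul]
      exact (tmulMultiplier_mul _ _ _ _).trans (by rw [one_mul])
  have h₂ : ∀ y : A ⊗[ℂ] V, tensorMultiplier (TensorProduct.map ofElem D' y) *
      tmulMultiplier 1 (oneTmul B c) = ofElem (g.lTensor A y) := by
    intro y
    induction y with
    | zero => simp
    | add x y hx hy => simp only [map_add, add_mul, hx, hy]
    | tmul u c =>
      rw [LinearMap.lTensor_tmul, ofElem_tmul, hg, TensorProduct.map_tmul]
      exact (tmulMultiplier_mul _ _ _ _).trans (by rw [mul_one])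
  have h₃ : ∀ z : (A ⊗[ℂ] B) ⊗[ℂ] C,
      assocMultiplier (ofElem z) = ofElem (TensorProduct.assoc ℂ A B C z) := by
    intro z
    refine Multiplier.ext' (fun w => ?_) (fun w => ?_)
    · change TensorProduct.assoc ℂ A B C (z * (TensorProduct.assoc ℂ A B C).symm w)
        = TensorProduct.assoc ℂ A B C z * w
      rw [assoc_mul, LinearEquiv.apply_symm_apply]
    · change TensorProduct.assoc ℂ A B C ((TensorProduct.assoc ℂ A B C).symm w * z)
        = w * TensorProduct.assoc ℂ A B C z
      rw [assoc_mul, LinearEquiv.apply_symm_apply]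
  rw [← h₃, ← h₁, ← h₂]
  exact h a c x y hx hy

lemma Cop.Realizes.coassoc {hU : HasNondegenerateProduct U} {hV : HasNondegenerateProduct V}
    {hW : HasNondegenerateProduct W} {hA : HasNondegenerateProduct A}
    {hB : HasNondegenerateProduct B} {hC : HasNondegenerateProduct C}
    {E : Cop hU.ndMul hA.ndMul hB.ndMul} {D : Cop hV.ndMul hU.ndMul hC.ndMul}
    {D' : Cop hV.ndMul hA.ndMul hW.ndMul} {E' : Cop hW.ndMul hB.ndMul hC.ndMul}
    {e : U →ₗ[ℂ] Multiplier (A ⊗[ℂ] B)} {d : V →ₗ[ℂ] Multiplier (U ⊗[ℂ] C)}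
    {d' : V →ₗ[ℂ] Multiplier (A ⊗[ℂ] W)} {e' : W →ₗ[ℂ] Multiplier (B ⊗[ℂ] C)}
    (hE : E.Realizes e) (hD : D.Realizes d) (hD' : D'.Realizes d') (hE' : E'.Realizes e')
    (h : ∀ v, CoassocIdentity (d v) e (d' v) e')
    (h' : ∀ v, CoassocIdentity (flip (d' v)) (flip ∘ₗ e') (flip (d v)) (flip ∘ₗ e)) :
    Coassoc E D D' E' where
  c₂₁ a v c := assoc_eq_of_coassocIdentity hA hB hC (h v) (hE.T₂ a) (fun w => hE'.T₁ w c)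
    (hD.T₁ v c) (hD'.T₂ a v)
  c₃₄ a v c := by
    have key := assoc_eq_of_coassocIdentity hC hB hA (h' v) (a := c) (c := a)
      (f := (TensorProduct.comm ℂ B C).toLinearMap ∘ₗ E'.T₄ c)
      (g := (TensorProduct.comm ℂ A B).toLinearMap ∘ₗ E.T₃.flip a)
      (x := TensorProduct.comm ℂ A W (D'.T₃ v a)) (y := TensorProduct.comm ℂ U C (D.T₄ c v))
      (fun w => by
        rw [LinearMap.comp_apply, LinearEquiv.coe_coe, ← flip_ofElem, hE'.T₄, flip_mul, oneTmul,
          flip_tmulMultiplier]; rfl)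
      (fun w => by
        rw [LinearMap.comp_apply, LinearEquiv.coe_coe, ← flip_ofElem, LinearMap.flip_apply, hE.T₃,
          flip_mul, tmulOne, flip_tmulMultiplier]; rfl)
      (by rw [← flip_ofElem, hD'.T₃, flip_mul, tmulOne, flip_tmulMultiplier]; rfl)
      (by rw [← flip_ofElem, hD.T₄, flip_mul, oneTmul, flip_tmulMultiplier]; rfl)
    have := flip_assoc _ _ _ _ key
    rw [← LinearMap.comp_assoc, ← LinearMap.comp_assoc] at this
    simpa using this

end Realize

/-! ### Families indexed by a group -/

section Family

variable {G : Type*} [Group G] {A : G → Type*} [∀ p, NonUnitalRing (A p)] [∀ p, Module ℂ (A p)]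
  [∀ p, IsScalarTower ℂ (A p) (A p)] [∀ p, SMulCommClass ℂ (A p) (A p)]

/-- The linear map underlying `Δ_{p,q}`, on `A_s` with `s = pq`. -/
def comulCast (Δ : ∀ p q : G, A (p * q) →ₙₐ[ℂ] Multiplier (A p ⊗[ℂ] A q)) {p q s : G}
    (h : p * q = s) : A s →ₗ[ℂ] Multiplier (A p ⊗[ℂ] A q) :=
  h ▸ comulLin Δ p q

lemma comulCast_cast (Δ : ∀ p q : G, A (p * q) →ₙₐ[ℂ] Multiplier (A p ⊗[ℂ] A q)) {p q s : G}
    (h : p * q = s) (a : A (p * q)) : comulCast Δ h (cast (congrArg A h) a) = Δ p q a := by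
  subst h; rfl

variable {Δ : ∀ p q : G, A (p * q) →ₙₐ[ℂ] Multiplier (A p ⊗[ℂ] A q)}

lemma IsRegularMultiplierHopf.exists_realizes (hΔ : IsRegularMultiplierHopf Δ) {p q s : G}
    (h : p * q = s) : ∃ E : Cop (hΔ.nondegenerate s).ndMul (hΔ.nondegenerate p).ndMul
      (hΔ.nondegenerate q).ndMul, E.Realizes (comulCast Δ h) := by
  subst h
  exact MultiplierHopf.exists_realizes _ _ _ (comulLin Δ p q) (map_mul (Δ p q))
    (hΔ.bijective p q) (hΔ.op_bijective p q)

/-- The two coassociativity conditions on `Δ` and `σΔ`. Having the products of indices as free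
variables allows `A_e` to be used with `ee = e` and `A_p` with `ep = p = pe`. -/
lemma IsRegularMultiplierHopf.coassoc_of_realizes (hΔ : IsRegularMultiplierHopf Δ)
    {p q r s t v : G} (h₁ : p * q = s) (h₂ : s * r = v) (h₃ : p * t = v) (h₄ : q * r = t)
    {E : Cop (hΔ.nondegenerate s).ndMul (hΔ.nondegenerate p).ndMul (hΔ.nondegenerate q).ndMul}
    {D : Cop (hΔ.nondegenerate v).ndMul (hΔ.nondegenerate s).ndMul (hΔ.nondegenerate r).ndMul}
    {D' : Cop (hΔ.nondegenerate v).ndMul (hΔ.nondegenerate p).ndMul (hΔ.nondegenerate t).ndMul}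
    {E' : Cop (hΔ.nondegenerate t).ndMul (hΔ.nondegenerate q).ndMul (hΔ.nondegenerate r).ndMul}
    (hE : E.Realizes (comulCast Δ h₁)) (hD : D.Realizes (comulCast Δ h₂))
    (hD' : D'.Realizes (comulCast Δ h₃)) (hE' : E'.Realizes (comulCast Δ h₄)) :
    Coassoc E D D' E' := by
  subst h₁ h₄ h₂
  have hcast : ∀ a : A (p * q * r), comulCast Δ h₃ a = Δ p (q * r) (castAssoc p q r a) := by
    intro a
    rw [← comulCast_cast Δ h₃, castAssoc, cast_cast, cast_eq]
  refine hE.coassoc hD hD' hE' (fun v => ?_) fun v => ?_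
  · rw [hcast]
    exact hΔ.coassoc p q r v
  · rw [hcast]
    exact hΔ.op_coassoc r q p v

lemma IsLeftInvariant.leftInv (hΔ : IsRegularMultiplierHopf Δ) {φ : ∀ p : G, A p →ₗ[ℂ] ℂ}
    (hφ : IsLeftInvariant Δ φ) {p q s : G} (h : p * q = s)
    {E : Cop (hΔ.nondegenerate s).ndMul (hΔ.nondegenerate p).ndMul (hΔ.nondegenerate q).ndMul}
    (hE : E.Realizes (comulCast Δ h)) : LeftInv E (φ s) (φ q) := by
  subst h
  have inj := ofElem_tmul_injective (hΔ.nondegenerate p) (hΔ.nondegenerate q)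
  refine ⟨fun a x => ?_, fun x a => ?_⟩
  · obtain ⟨z, hz, hz'⟩ := (hφ p q a x).1
    rw [inj ((hE.T₃ a x).trans hz.symm)]
    exact hz'.symm
  · obtain ⟨z, hz, hz'⟩ := (hφ p q a x).2
    rw [inj ((hE.T₂ x a).trans hz.symm)]
    exact hz'.symm

lemma IsRightInvariant.leftInv_coop (hΔ : IsRegularMultiplierHopf Δ) {ψ : ∀ p : G, A p →ₗ[ℂ] ℂ}
    (hψ : IsRightInvariant Δ ψ) {p q s : G} (h : p * q = s)
    {E : Cop (hΔ.nondegenerate s).ndMul (hΔ.nondegenerate p).ndMul (hΔ.nondegenerate q).ndMul}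
    (hE : E.Realizes (comulCast Δ h)) : LeftInv E.coop (ψ s) (ψ p) := by
  subst h
  have inj := ofElem_tmul_injective (hΔ.nondegenerate p) (hΔ.nondegenerate q)
  refine ⟨fun a x => ?_, fun x a => ?_⟩
  · obtain ⟨z, hz, hz'⟩ := (hψ p q a x).1
    refine (slR_comm (ψ p) (E.T₁ a x)).trans ?_
    rw [inj ((hE.T₁ a x).trans hz.symm)]
    exact hz'.symm
  · obtain ⟨z, hz, hz'⟩ := (hψ p q a x).2
    refine (slR_comm (ψ p) (E.T₄ x a)).trans ?_
    rw [inj ((hE.T₄ x a).trans hz.symm)]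
    exact hz'.symm

/-- The two sides of faithfulness are exchanged by passing to the opposite products. -/
lemma Cop.isFaithful {H B : Type*} [NonUnitalRing H] [Module ℂ H] [IsScalarTower ℂ H H]
    [SMulCommClass ℂ H H] [NonUnitalRing B] [Module ℂ B] [IsScalarTower ℂ B B]
    [SMulCommClass ℂ B B] {hH : HasNondegenerateProduct H} {hB : HasNondegenerateProduct B}
    {D : Cop hH.ndMul hH.ndMul hH.ndMul} (hD : Coassoc D D D D)
    {l : Cop hB.ndMul hH.ndMul hB.ndMul} {r : Cop hB.ndMul hB.ndMul hH.ndMul}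
    (hlr : Coassoc l r l r) {φB : B →ₗ[ℂ] ℂ} {φH : H →ₗ[ℂ] ℂ} (hφH : LeftInv D φH φH)
    (hφB : LeftInv r φB φH) (h0 : φH ≠ 0) : IsFaithful φB :=
  ⟨fun _ hn => eq_zero_of_forall_apply_mul hD.op hlr.op hφH.op hφB.op h0 hn,
    fun _ hn => eq_zero_of_forall_apply_mul hD hlr hφH hφB h0 hn⟩

end Family

end MultiplierHopf

theorem mainTheorem11 {G : Type*} [Group G] {A : G → Type*}
    [∀ p, NonUnitalRing (A p)] [∀ p, Module ℂ (A p)]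
    [∀ p, IsScalarTower ℂ (A p) (A p)] [∀ p, SMulCommClass ℂ (A p) (A p)]
    (Δ : ∀ p q : G, A (p * q) →ₙₐ[ℂ] MultiplierHopf.Multiplier (A p ⊗[ℂ] A q))
    (hΔ : MultiplierHopf.IsRegularMultiplierHopf Δ) :
    (∀ φ : ∀ p : G, A p →ₗ[ℂ] ℂ, MultiplierHopf.IsLeftInvariant Δ φ → (∃ p, φ p ≠ 0) →
      (∀ φ' : ∀ p : G, A p →ₗ[ℂ] ℂ, MultiplierHopf.IsLeftInvariant Δ φ' →
        ∃ c : ℂ, ∀ p, φ' p = c • φ p) ∧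
      ∀ p, MultiplierHopf.IsFaithful (φ p)) ∧
    (∀ ψ : ∀ p : G, A p →ₗ[ℂ] ℂ, MultiplierHopf.IsRightInvariant Δ ψ → (∃ p, ψ p ≠ 0) →
      (∀ ψ' : ∀ p : G, A p →ₗ[ℂ] ℂ, MultiplierHopf.IsRightInvariant Δ ψ' →
        ∃ c : ℂ, ∀ p, ψ' p = c • ψ p) ∧
      ∀ p, MultiplierHopf.IsFaithful (ψ p)) := by
  open MultiplierHopf in
  obtain ⟨D, hD⟩ := hΔ.exists_realizes (one_mul (1 : G))
  choose l hl using fun p : G => hΔ.exists_realizes (one_mul p)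
  choose r hr using fun p : G => hΔ.exists_realizes (mul_one p)
  have hDD : Coassoc D D D D := hΔ.coassoc_of_realizes _ _ _ _ hD hD hD hD
  have hlr : ∀ p, Coassoc (l p) (r p) (l p) (r p) := fun p =>
    hΔ.coassoc_of_realizes _ _ _ _ (hl p) (hr p) (hl p) (hr p)
  refine ⟨fun φ hφ ⟨p₀, hp₀⟩ => ?_, fun ψ hψ ⟨p₀, hp₀⟩ => ?_⟩
  · have h1 : φ 1 ≠ 0 := (hφ.leftInv hΔ _ (hr p₀)).ne_zero hp₀
    refine ⟨fun φ' hφ' => ?_, fun p => Cop.isFaithful hDD (hlr p) (hφ.leftInv hΔ _ hD)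
      (hφ.leftInv hΔ _ (hr p)) h1⟩
    obtain ⟨c, hc⟩ := exists_eq_smul hDD (hφ.leftInv hΔ _ hD) h1 (hφ'.leftInv hΔ _ hD)
    exact ⟨c, fun p => (hφ.leftInv hΔ _ (hr p)).eq_smul (hc ▸ hφ'.leftInv hΔ _ (hr p))⟩
  · have h1 : ψ 1 ≠ 0 := (hψ.leftInv_coop hΔ _ (hl p₀)).ne_zero hp₀
    refine ⟨fun ψ' hψ' => ?_, fun p => Cop.isFaithful hDD.coop (hlr p).coop
      (hψ.leftInv_coop hΔ _ hD) (hψ.leftInv_coop hΔ _ (hl p)) h1⟩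
    obtain ⟨c, hc⟩ := exists_eq_smul hDD.coop (hψ.leftInv_coop hΔ _ hD) h1
      (hψ'.leftInv_coop hΔ _ hD)
    exact ⟨c, fun p => (hψ.leftInv_coop hΔ _ (hl p)).eq_smul (hc ▸ hψ'.leftInv_coop hΔ _ (hl p))⟩
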